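/- Let $R$ be the root system of type $E_6$ with simple roots $\alpha_1,\dots,\alpha_6$ (Bourbaki numbering), simple reflections $s_1,\dots,s_6$, Weyl group $W$, and highest root $\tilde\alpha$. Consider the root datum $(X^*,X_*,R,R^\vee)$ with $X^*=Q(R)$ the root lattice and $X_*=P(R^\vee)$ the coweight lattice, and let $\rho_1,\dots,\rho_6\in X_*$ be the fundamental coweights, i.e. the basis dual to $\alpha_1,\dots,\alpha_6$. Put $V=X_*\otimes\mathbb R$, $W_a=Q(R^\vee)\rtimes W$ and $\widetilde W=X_*\rtimes W$, acting on $V$ by affine transformations; $t_\nu\in\widetilde W$ denotes translation by $\nu\in X_*$. Let $\mathfrak A=\{v\in V: \langle\alpha_i,v\rangle>0 \text{ for } i=1,\dots,6,\ \langle\tilde\alpha,v\rangle<1\}$ be the base alcove and $\Omega\subset\widetilde W$ its stabilizer, so that $\widetilde W=W_a\rtimes\Omega$. The Bruhat order on the Coxeter group $W_a$ (whose simple reflections are the reflections in the walls of $\mathfrak A$) is extended to $\widetilde W$ by: $y\omega\le y'\omega'$ if and only if $\omega=\omega'$ and $y\le y'$, for $y,y'\in W_a$ and $\omega,\omega'\in\Omega$.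 For $\mu\in X_*$ let $\mathrm{Adm}(\mu)$ be the set of all $x\in\widetilde W$ with $x\le t_{w(\mu)}$ for some $w\in W$. Let $\mathrm{Perm}(\mu)$ be the set of all $x\in\widetilde W$ such that $x$ and $t_\mu$ have the same component in $\Omega$ and $x(v)-v$ lies in the convex hull of the orbit $W\mu$ for every $v\in\overline{\mathfrak A}$. Call $\mu$ minuscule if $\langle\alpha,\mu\rangle\in\{-1,0,1\}$ for all $\alpha\in R$, and dominant if $\langle\alpha_i,\mu\rangle\ge 0$ for $i=1,\dots,6$. Then: 1. For $\mu=\rho_1$, $w_1=s_2s_4s_5s_6s_3s_4s_5s_2s_4s_3s_1$ and $w_2=s_4s_5s_6s_2s_4s_5$, the element $x=w_2t_\mu w_1^{-1}\in\widetilde W$ satisfies $x\in\mathrm{Perm}(\mu)$ and $x\notin\mathrm{Adm}(\mu)$. 2. Hence $\mathrm{Adm}(\rho_1)\ne\mathrm{Perm}(\rho_1)$, and also $\mathrm{Adm}(\rho_6)\ne\mathrm{Perm}(\rho_6)$. 3. The nonzero dominant minuscule coweights are exactly $\rho_1$ and $\rho_6$, and $\mathrm{Adm}(\mu)\ne\mathrm{Perm}(\mu)$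 for every nonzero minuscule coweight $\mu\in X_*$. -/

import Mathlib

noncomputable section

open scoped TensorProduct

/-! ### Bruhat order of a group with respect to a set of simple reflections -/

namespace Bruhat

variable {G : Type*} [Group G] (S : Set G)

/-- The length of `g`: the least number of factors in a word in `S` with product `g`
(used only for elements that are products of elements of `S`, where `S` consists of
involutions). -/
def length (g : G) : ℕ :=
  sInf {n : ℕ | ∃ l : List G, (∀ s ∈ l, s ∈ S) ∧ l.prod = g ∧ l.length = n}

/-- The reflections: all conjugates of the simple reflections. -/
def reflections : Set G := {t | ∃ g : G, ∃ s ∈ S, t = g * s * g⁻¹}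

/-- The Bruhat order: the reflexive transitive closure of `u < u * t`, for `t` a reflection
with `length u < length (u * t)`. -/
def le (u v : G) : Prop :=
  Relation.ReflTransGen
    (fun a b => ∃ t ∈ reflections S, b = a * t ∧ length S a < length S b) u v

end Bruhat

/-! ### Extended affine Weyl group, admissible and permissible sets of a root datum -/

namespace RootDatum

variable {ι X Y : Type*} [AddCommGroup X] [AddCommGroup Y] (P : RootDatum ι X Y)

/-- The finite Weyl group, acting on the cocharacter lattice `Y = X_*`. -/
def W : Subgroup (Y ≃ₗ[ℤ] Y) := Subgroup.closure (Set.range P.coreflection)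

/-- The reflection of the root with index `i`, as an element of the finite Weyl group. -/
def refl (i : ι) : W P := ⟨P.coreflection i, Subgroup.subset_closure (Set.mem_range_self i)⟩

/-- The action of the finite Weyl group on the cocharacter lattice, written multiplicatively. -/
def actHom : W P →* MulAut (Multiplicative Y) where
  toFun w := AddEquiv.toMultiplicative (w : Y ≃ₗ[ℤ] Y).toAddEquiv
  map_one' := rfl
  map_mul' _ _ := rfl

/-- The extended affine Weyl group `X_* ⋊ W`. -/
abbrev ExtAffineWeyl : Type _ := Multiplicative Y ⋊[actHom P] W P

/-- The translation element `t_ν`. -/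
def t (ν : Y) : ExtAffineWeyl P := SemidirectProduct.inl (Multiplicative.ofAdd ν)

/-- The inclusion of the finite Weyl group in the extended affine Weyl group. -/
def fin : W P →* ExtAffineWeyl P := SemidirectProduct.inr

/-- The coroot lattice `Q(R^∨) = ℤR^∨`. -/
def corootLattice : AddSubgroup Y := AddSubgroup.closure (Set.range P.coroot)

theorem smul_mem_corootLattice (w : W P) {q : Y} (hq : q ∈ corootLattice P) :
    (w : Y ≃ₗ[ℤ] Y) q ∈ corootLattice P := by
  obtain ⟨w, hw⟩ := w
  have key : ∀ i, ∀ q ∈ corootLattice P, P.coreflection i q ∈ corootLattice P := by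
    intro i q hq
    rw [RootPairing.coreflection_apply]
    exact sub_mem hq (zsmul_mem (AddSubgroup.subset_closure (Set.mem_range_self i)) _)
  change w q ∈ corootLattice P
  induction hw using Subgroup.closure_induction'' generalizing q with
  | mem w hw =>
    obtain ⟨i, rfl⟩ := hw
    exact key i q hq
  | inv_mem w hw =>
    obtain ⟨i, rfl⟩ := hw
    have : (P.coreflection i)⁻¹ = P.coreflection i := P.coreflection_inv i
    rw [this]
    exact key i q hq
  | one => exact hq
  | mul a b _ _ ha hb => exact ha (hb hq)

/-- The affine Weyl group `W_a = Q(R^∨) ⋊ W`, as a subgroup of `X_* ⋊ W`. -/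
def affineWeyl : Subgroup (ExtAffineWeyl P) where
  carrier := {x | x.left.toAdd ∈ corootLattice P}
  one_mem' := (corootLattice P).zero_mem
  mul_mem' {a _} ha hb := add_mem (S := AddSubgroup Y) ha (smul_mem_corootLattice P a.right hb)
  inv_mem' {a} ha := smul_mem_corootLattice P a.right⁻¹ (neg_mem (S := AddSubgroup Y) ha)

variable (Y) in
/-- The real vector space `V = X_* ⊗ ℝ`. -/
abbrev V : Type _ := ℝ ⊗[ℤ] Y

/-- The real linear form `v ↦ ⟨α, v⟩` on `V` given by the root `α` with index `i`. -/
def pair (i : ι) : V Y →ₗ[ℝ] ℝ := Module.Dual.baseChange ℝ (P.root' i)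

theorem pair_tmul (i : ι) (r : ℝ) (ν : Y) : pair P i (r ⊗ₜ[ℤ] ν) = r * (P.root' i ν : ℤ) := by
  simp [pair, mul_comm]

/-- The action of the extended affine Weyl group on `V` by affine transformations:
`t_ν w` sends `v` to `w(v) + ν`. -/
def act (x : ExtAffineWeyl P) (v : V Y) : V Y :=
  ((x.right : Y ≃ₗ[ℤ] Y).toLinearMap.baseChange ℝ) v + (1 : ℝ) ⊗ₜ[ℤ] x.left.toAdd

theorem act_one (v : V Y) : act P 1 v = v := by
  change LinearMap.baseChange ℝ (LinearMap.id : Y →ₗ[ℤ] Y) v + (1 : ℝ) ⊗ₜ[ℤ] (0 : Y) = v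
  simp

theorem act_mul (x y : ExtAffineWeyl P) (v : V Y) : act P (x * y) v = act P x (act P y v) := by
  change LinearMap.baseChange ℝ
      ((x.right : Y ≃ₗ[ℤ] Y).toLinearMap ∘ₗ (y.right : Y ≃ₗ[ℤ] Y).toLinearMap) v
      + (1 : ℝ) ⊗ₜ[ℤ] (x.left.toAdd + (x.right : Y ≃ₗ[ℤ] Y) y.left.toAdd) = _
  simp only [act, LinearMap.baseChange_comp, LinearMap.comp_apply, map_add,
    LinearMap.baseChange_tmul, TensorProduct.tmul_add, LinearEquiv.coe_coe]
  abel

variable {P} (b : P.Base)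

/-- The root with index `θ` is the highest root: for every root `β`, the difference `θ - β` is a
sum of simple roots. (Such a root is unique, and exists if the root system is irreducible, which
is the case in which the notions below are used.) -/
def IsHighest (θ : ι) : Prop :=
  ∀ j, P.root θ - P.root j ∈ AddSubmonoid.closure (P.root '' b.support)

/-- The base alcove. -/
def alcove : Set (V Y) :=
  {v | (∀ i ∈ b.support, 0 < pair P i v) ∧ ∀ θ, IsHighest b θ → pair P θ v < 1}

/-- The closure of the base alcove for the canonical topology of the real vector space `V`. -/
def closedAlcove : Set (V Y) := @closure (V Y) (moduleTopology ℝ (V Y)) (alcove b)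

/-- The stabilizer `Ω` of the base alcove in the extended affine Weyl group. -/
def stab : Set (ExtAffineWeyl P) := {x | act P x '' alcove b = alcove b}

/-- The simple reflections of the affine Weyl group, that is, the reflections in the walls of the
base alcove: the simple reflections of the finite Weyl group, together with
`s_0 = t_{θ^∨} s_θ` for `θ` the highest root. -/
def simpleReflections : Set (affineWeyl P) :=
  {y | (∃ i ∈ b.support, (y : ExtAffineWeyl P) = fin P (refl P i)) ∨
    ∃ θ, IsHighest b θ ∧ (y : ExtAffineWeyl P) = t P (P.coroot θ) * fin P (refl P θ)}

/-- The Bruhat order on the extended affine Weyl group: `y ω ≤ y' ω'` if and only if `ω = ω'` and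
`y ≤ y'`, for `y, y'` in the affine Weyl group and `ω, ω'` in the stabilizer of the alcove. -/
def bruhatLE (x x' : ExtAffineWeyl P) : Prop :=
  ∃ y y' : affineWeyl P, ∃ ω ∈ stab b, x = y * ω ∧ x' = y' * ω ∧
    Bruhat.le (simpleReflections b) y y'

/-- The `μ`-admissible set. -/
def Adm (μ : Y) : Set (ExtAffineWeyl P) :=
  {x | ∃ w : W P, bruhatLE b x (t P ((w : Y ≃ₗ[ℤ] Y) μ))}

variable (P) in
/-- The convex hull `P_μ` in `V` of the Weyl group orbit of `μ`. -/
def hull (μ : Y) : Set (V Y) :=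
  convexHull ℝ {v | ∃ w : W P, v = (1 : ℝ) ⊗ₜ[ℤ] (w : Y ≃ₗ[ℤ] Y) μ}

/-- The `μ`-permissible set: `x` and `t_μ` have the same component in `Ω`, and `x` moves every
point of the closed base alcove by a vector in `P_μ`. -/
def Perm (μ : Y) : Set (ExtAffineWeyl P) :=
  {x | (∃ y₁ y₂ : affineWeyl P, ∃ ω ∈ stab b, x = y₁ * ω ∧ t P μ = y₂ * ω) ∧
    ∀ v ∈ closedAlcove b, act P x v - v ∈ hull P μ}

variable (P) in
/-- `μ` is minuscule: `⟨α, μ⟩ ∈ {-1, 0, 1}` for every root `α`. -/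
def IsMinuscule (μ : Y) : Prop :=
  ∀ i, P.root' i μ = -1 ∨ P.root' i μ = 0 ∨ P.root' i μ = 1

/-- `μ` is dominant: `⟨α, μ⟩ ≥ 0` for every simple root `α`. -/
def IsDominant (μ : Y) : Prop := ∀ i ∈ b.support, 0 ≤ P.root' i μ

end RootDatum

/-! ### The root datum `(Q(R), P(R^∨))` for `R` of type `E₆` -/

namespace E6

open Matrix

/-- The lattice `ℤ^6`. As character lattice `X^* = Q(R)`, coordinates are with respect to the
simple roots; as cocharacter lattice `X_* = P(R^∨)`, they are with respect to the dual basis of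
fundamental coweights. -/
abbrev L : Type := Fin 6 → ℤ

/-- The invariant form of the root lattice, normalized so that all roots have square length 2. -/
def q (m n : L) : ℤ := m ⬝ᵥ (CartanMatrix.E₆ *ᵥ n)

/-- The roots: the vectors of square length 2 in the root lattice. -/
abbrev Idx : Type := {n : L // q n n = 2}

theorem q_comm (m n : L) : q m n = q n m := by
  simp [q, CartanMatrix.E₆, dotProduct, mulVec, Fin.sum_univ_succ]
  ring

theorem q_add (k m n : L) : q (k + m) n = q k n + q m n := by simp [q, add_dotProduct]

theorem q_smul (a : ℤ) (m n : L) : q (a • m) n = a * q m n := by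
  rw [q, smul_dotProduct, smul_eq_mul, q]

theorem q_reflect {m : L} (n : L) (hm : q m m = 2) :
    q (n - q n m • m) (n - q n m • m) = q n n := by
  rw [sub_eq_add_neg, ← neg_smul]
  generalize hc : q n m = c
  rw [q_add, q_smul, q_comm n, q_comm m, q_add, q_add, q_smul, q_smul, q_comm m n, hm, hc]
  ring

theorem mulVec_injective {m n : L} (h : CartanMatrix.E₆ *ᵥ m = CartanMatrix.E₆ *ᵥ n) : m = n := by
  have h' : ∀ i, (CartanMatrix.E₆ *ᵥ m) i = (CartanMatrix.E₆ *ᵥ n) i := fun i => by rw [h]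
  simp [CartanMatrix.E₆, dotProduct, mulVec, Fin.sum_univ_succ, Fin.forall_fin_succ] at h'
  ext i
  fin_cases i <;> simp <;> lia

/-- The permutation of the roots induced by the reflection of the root `i`. -/
def reflPerm (i : Idx) : Idx ≃ Idx :=
  Function.Involutive.toPerm (fun j => ⟨j.1 - q j.1 i.1 • i.1, (q_reflect _ i.2).trans j.2⟩) (by
    intro j
    apply Subtype.ext
    have : q (j.1 - q j.1 i.1 • i.1) i.1 = - q j.1 i.1 := by
      rw [sub_eq_add_neg, ← neg_smul, q_add, q_smul, i.2]; ring
    simp only [this]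
    module)

/-- The root datum `(Q(R), P(R^∨))` of type `E₆`, with the standard pairing of `ℤ^6` with itself.
The coroot of a root `n` is the cocharacter `m ↦ q m n`, since all roots have square length 2. -/
def datum : RootDatum Idx L L where
  toLinearMap := dotProductBilin ℤ ℤ
  isPerfPair_toLinearMap := by
    apply LinearMap.IsPerfPair.of_bijective
    constructor
    · intro m n h
      ext i
      simpa using LinearMap.congr_fun h (Pi.single i 1)
    · intro f
      refine ⟨fun i => f (Pi.single i 1), LinearMap.pi_ext' fun i => ?_⟩
      ext
      simp
  root := Function.Embedding.subtype _
  coroot := ⟨fun n => CartanMatrix.E₆ *ᵥ n.1, fun _ _ h => Subtype.ext (mulVec_injective h)⟩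
  root_coroot_two n := n.2
  reflectionPerm := reflPerm
  reflectionPerm_root _ _ := rfl
  reflectionPerm_coroot i j := by
    change CartanMatrix.E₆ *ᵥ j.1 - q i.1 j.1 • CartanMatrix.E₆ *ᵥ i.1 =
      CartanMatrix.E₆ *ᵥ (j.1 - q j.1 i.1 • i.1)
    rw [mulVec_sub, mulVec_smul, q_comm]

/-- The simple roots `α_1, …, α_6`, as `simple 0, …, simple 5`. -/
def simple (i : Fin 6) : Idx := ⟨Pi.single i 1, by fin_cases i <;> decide⟩

theorem simple_injective : Function.Injective simple := fun i j h => by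
  by_contra hij
  simpa [simple, Pi.single_apply, hij] using congrFun (congrArg Subtype.val h) i

theorem q_self (n : L) : q n n = 2 * (n 0 ^ 2 + n 1 ^ 2 + n 2 ^ 2 + n 3 ^ 2 + n 4 ^ 2 + n 5 ^ 2
    - n 0 * n 2 - n 1 * n 3 - n 2 * n 3 - n 3 * n 4 - n 4 * n 5) := by
  simp [q, CartanMatrix.E₆, dotProduct, mulVec, Fin.sum_univ_succ]
  ring

/-- The form is positive definite. -/
theorem q_pos {n : L} (hn : n ≠ 0) : 2 ≤ q n n := by
  have key : 12 * q n n = 6 * (2 * n 0 - n 2) ^ 2 + 6 * (2 * n 1 - n 3) ^ 2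
      + 2 * (3 * n 2 - 2 * n 3) ^ 2 + 6 * (2 * n 5 - n 4) ^ 2 + 2 * (3 * n 4 - 2 * n 3) ^ 2
      + 2 * n 3 ^ 2 := by
    rw [q_self]; ring
  by_contra! hlt
  have heven : q n n ≤ 0 := by rw [q_self] at hlt ⊢; lia
  apply hn
  have h1 : (2 * n 0 - n 2) ^ 2 = 0 := by nlinarith
  have h2 : (2 * n 1 - n 3) ^ 2 = 0 := by nlinarith
  have h3 : (3 * n 2 - 2 * n 3) ^ 2 = 0 := by nlinarith
  have h4 : (2 * n 5 - n 4) ^ 2 = 0 := by nlinarith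
  have h5 : (3 * n 4 - 2 * n 3) ^ 2 = 0 := by nlinarith
  have h6 : n 3 ^ 2 = 0 := by nlinarith
  simp only [pow_eq_zero_iff, ne_eq, OfNat.ofNat_ne_zero, not_false_eq_true] at h1 h2 h3 h4 h5 h6
  ext i
  fin_cases i <;> simp <;> lia

/-- Every root is a sum of simple roots or the negative of such a sum. -/
theorem nonneg_or_nonpos (n : Idx) : (∀ i, 0 ≤ n.1 i) ∨ (∀ i, 0 ≤ -n.1 i) := by
  obtain ⟨n, hn⟩ := n
  have hp : ∀ i, 0 ≤ (n⁺) i ∧ 0 ≤ (n⁻) i ∧ (n⁺) i * (n⁻) i = 0 ∧ n i = (n⁺) i - (n⁻) i := by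
    intro i
    rw [Pi.posPart_apply, Pi.negPart_apply]
    rcases le_total 0 (n i) with h | h
    · simp [h]
    · simp [h]
  generalize n⁺ = p at hp
  generalize n⁻ = m at hp
  have hnpm : n = p + (-1 : ℤ) • m := by ext i; simp [(hp i).2.2.2, sub_eq_add_neg]
  have hpm : q p m ≤ 0 := by
    have e : q p m = 2 * (p 0 * m 0 + p 1 * m 1 + p 2 * m 2 + p 3 * m 3 + p 4 * m 4 + p 5 * m 5)
        - p 0 * m 2 - p 2 * m 0 - p 1 * m 3 - p 3 * m 1 - p 2 * m 3 - p 3 * m 2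
        - p 3 * m 4 - p 4 * m 3 - p 4 * m 5 - p 5 * m 4 := by
      simp [q, CartanMatrix.E₆, dotProduct, mulVec, Fin.sum_univ_succ]
      ring
    rw [e]
    simp only [(hp _).2.2.1]
    have h := fun i j => mul_nonneg (hp i).1 (hp j).2.1
    linarith [h 0 2, h 2 0, h 1 3, h 3 1, h 2 3, h 3 2, h 3 4, h 4 3, h 4 5, h 5 4]
  have hq : q n n = q p p + q m m - 2 * q p m := by
    rw [hnpm, q_add, q_smul, q_comm p, q_comm m, q_add, q_add, q_smul, q_smul, q_comm m p]
    ring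
  by_cases h0 : p = 0
  · right
    intro i
    have := hp i
    simp only [h0, Pi.zero_apply] at this
    change 0 ≤ -n i
    lia
  by_cases h1 : m = 0
  · left
    intro i
    have := hp i
    simp only [h1, Pi.zero_apply] at this
    change 0 ≤ n i
    lia
  have := q_pos h0
  have := q_pos h1
  lia

theorem mem_closure_simple {n : L} (hn : ∀ i, 0 ≤ n i) :
    n ∈ AddSubmonoid.closure (datum.root '' (Finset.univ.image simple : Finset Idx)) := by
  have : n = ∑ i, (n i).toNat • datum.root (simple i) := by
    ext j
    have : ∀ i, datum.root (simple i) = Pi.single i 1 := fun _ => rfl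
    simp [this, Finset.sum_apply, Pi.single_apply, hn]
  rw [this]
  refine sum_mem fun i _ => nsmul_mem (AddSubmonoid.subset_closure
    (Set.mem_image_of_mem _ (by simp))) _

/-- The action of the Cartan matrix, which sends roots to coroots. -/
def toCoroot : L →ₗ[ℤ] L := CartanMatrix.E₆.mulVecLin

theorem mem_closure_simple' {n : L} (hn : ∀ i, 0 ≤ n i) :
    toCoroot n ∈ AddSubmonoid.closure (datum.coroot '' (Finset.univ.image simple : Finset Idx)) := by
  have h := AddSubmonoid.mem_map_of_mem toCoroot.toAddMonoidHom (mem_closure_simple hn)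
  rw [AddMonoidHom.map_mclosure, Set.image_image] at h
  exact h

theorem linearIndepOn_root :
    LinearIndepOn ℤ datum.root ((Finset.univ.image simple : Finset Idx) : Set Idx) := by
  have h := (Pi.basisFun ℤ (Fin 6)).linearIndependent
  have h2 : LinearIndependent ℤ (datum.root ∘ simple) := by
    convert h using 1
    · ext i : 1
      simp [datum, simple]
    · exact Subsingleton.elim _ _
  rw [Finset.coe_image, Finset.coe_univ, Set.image_univ]
  exact (linearIndepOn_range_iff simple_injective _).2 h2

/-- The base `α_1, …, α_6`. -/
def base : datum.Base where
  support := Finset.univ.image simple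
  linearIndepOn_root := linearIndepOn_root
  linearIndepOn_coroot := linearIndepOn_root.map_injOn toCoroot
    (fun _ _ _ _ h => mulVec_injective h)
  root_mem_or_neg_mem n := (nonneg_or_nonpos n).imp mem_closure_simple mem_closure_simple
  coroot_mem_or_neg_mem n := (nonneg_or_nonpos n).imp mem_closure_simple'
    (fun h => by
      have := mem_closure_simple' (n := -n.1) h
      rwa [map_neg] at this)

/-- The Cartan matrix of the base is the one of type `E₆`. -/
theorem pairing_simple (i j : Fin 6) :
    datum.pairing (simple i) (simple j) = CartanMatrix.E₆ i j := by
  fin_cases i <;> fin_cases j <;> decide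

/-- The character lattice is the root lattice. -/
theorem span_root : Submodule.span ℤ (Set.range datum.root) = ⊤ := by
  refine eq_top_iff.2 fun n _ => ?_
  rw [pi_eq_sum_univ n]
  refine sum_mem fun i _ => Submodule.smul_mem _ _ (Submodule.subset_span ⟨simple i, ?_⟩)
  ext j
  simp [datum, simple, Pi.single_apply, eq_comm]

/-- The fundamental coweights: `rho i` is the element of `P(R^∨)` dual to `simple i`. Hence `ρ_1`
is `rho 0` and `ρ_6` is `rho 5`. -/
def rho (i : Fin 6) : L := Pi.single i 1

theorem root_rho (i j : Fin 6) : datum.root' (simple i) (rho j) = if i = j then 1 else 0 := by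
  revert i j
  decide

/-- The simple reflections of the finite Weyl group: `s_1, …, s_6` are `s 0, …, s 5`. -/
def s (i : Fin 6) : RootDatum.W datum := RootDatum.refl datum (simple i)

/-- `w_1 = s_2 s_4 s_5 s_6 s_3 s_4 s_5 s_2 s_4 s_3 s_1`. -/
def w₁ : RootDatum.W datum := s 1 * s 3 * s 4 * s 5 * s 2 * s 3 * s 4 * s 1 * s 3 * s 2 * s 0

/-- `w_2 = s_4 s_5 s_6 s_2 s_4 s_5`. -/
def w₂ : RootDatum.W datum := s 3 * s 4 * s 5 * s 1 * s 3 * s 4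

/-- The element `x = w_2 t_μ w_1^{-1}` for `μ = ρ_1`. -/
def x : RootDatum.ExtAffineWeyl datum :=
  RootDatum.fin datum w₂ * RootDatum.t datum (rho 0) * (RootDatum.fin datum w₁)⁻¹

end E6

/-!
By convexity, permissibility of an element only has to be checked at the vertices of the base
alcove; there the displacement is exhibited as an average of points of the orbit of `μ`.

For non-admissibility, let `u < r u` in the Bruhat order, where `r` is the reflection in a positive
affine root `a`. By the exchange property `a` is nonnegative on `u(𝔄)`, so `r` either fixes `u(v)`
or moves it away from the alcove, for every point `v` of the closed alcove. For `v = ρ₄ / 3` there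
is a small finite set of points that contains `x(v)` and that, together with all points far from
`v`, is closed under such moves. Were `x` admissible, this set would contain some `v + w(μ)`; but
that point is not far from `v`, since `μ` is minuscule, and no point of the finite set is congruent
to `v` modulo the coweight lattice.

The data for `ρ₆` are those for `ρ₁` under the automorphism of the Dynkin diagram, and every other
nonzero minuscule coweight lies in the `W`-orbit of `ρ₁` or `ρ₆`.
-/

/-! ### Exchange property -/

/-- A *positive system* for a set `S` of elements of a group `G` acting on a set `Φ` of roots:
`r a` is the reflection in the root `a`, and a simple reflection `s ∈ S` makes no positive root
negative except those whose reflection is `s`. This is what the proof of the strong exchange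
property uses. A root and its negative have the same reflection, so no negation on `Φ` is needed. -/
structure PositiveSystem {G Φ : Type*} [Group G] [MulAction G Φ] (S : Set G) (r : Φ → G)
    (Pos : Set Φ) : Prop where
  refl_smul (g : G) (a : Φ) : r (g • a) = g * r a * g⁻¹
  refl_mul_self (a : Φ) : r a * r a = 1
  exists_pos (a : Φ) : ∃ a' ∈ Pos, r a' = r a
  subset_range : S ⊆ Set.range r
  refl_eq_of_smul_notMem {s : G} (hs : s ∈ S) {a : Φ} (ha : a ∈ Pos) (hsa : s • a ∉ Pos) : r a = s

namespace PositiveSystem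

variable {G Φ : Type*} [Group G] [MulAction G Φ] {S : Set G} {r : Φ → G} {Pos : Set Φ}

theorem inv_eq_self (h : PositiveSystem S r Pos) {s : G} (hs : s ∈ S) : s⁻¹ = s := by
  obtain ⟨a, rfl⟩ := h.subset_range hs
  exact inv_eq_of_mul_eq_one_left (h.refl_mul_self a)

theorem exists_shorter_word (h : PositiveSystem S r Pos) {l : List G} (hl : ∀ s ∈ l, s ∈ S)
    {a : Φ} (ha : a ∈ Pos) (hla : l.prod⁻¹ • a ∉ Pos) :
    ∃ l' : List G, (∀ s ∈ l', s ∈ S) ∧ l'.length < l.length ∧ l'.prod = r a * l.prod := by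
  induction l generalizing a with
  | nil => simp [ha] at hla
  | cons s l ih =>
    obtain ⟨hs, hl⟩ := List.forall_mem_cons.1 hl
    rw [List.prod_cons, mul_inv_rev, mul_smul] at hla
    by_cases hsa : s⁻¹ • a ∈ Pos
    · obtain ⟨l', hl', hlt, hprod⟩ := ih hl hsa hla
      refine ⟨s :: l', List.forall_mem_cons.2 ⟨hs, hl'⟩, by simpa using hlt, ?_⟩
      rw [List.prod_cons, List.prod_cons, hprod, h.refl_smul]
      group
    · rw [h.inv_eq_self hs] at hsa
      refine ⟨l, hl, by simp, ?_⟩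
      rw [List.prod_cons, ← h.refl_eq_of_smul_notMem hs ha hsa, ← mul_assoc, h.refl_mul_self,
        one_mul]

theorem exists_word (h : PositiveSystem S r Pos) (hS : Subgroup.closure S = ⊤) (g : G) :
    ∃ l : List G, (∀ s ∈ l, s ∈ S) ∧ l.prod = g := by
  have hg : g ∈ (Subgroup.closure S).toSubmonoid := by simp [hS]
  rw [Subgroup.closure_toSubmonoid] at hg
  obtain ⟨l, hl, hprod⟩ := Submonoid.exists_list_of_mem_closure hg
  refine ⟨l, fun s hs => (hl s hs).elim id fun hs' => ?_, hprod⟩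
  rw [Set.mem_inv] at hs'
  rwa [← inv_inv s, h.inv_eq_self hs']

theorem length_refl_mul_lt (h : PositiveSystem S r Pos) (hS : Subgroup.closure S = ⊤) {g : G}
    {a : Φ} (ha : a ∈ Pos) (hga : g⁻¹ • a ∉ Pos) :
    Bruhat.length S (r a * g) < Bruhat.length S g := by
  obtain ⟨l, hl, hprod, hlen⟩ := Nat.sInf_mem
    (let ⟨l, hl, hprod⟩ := h.exists_word hS g; ⟨l.length, l, hl, hprod, rfl⟩ :
      {n : ℕ | ∃ l : List G, (∀ s ∈ l, s ∈ S) ∧ l.prod = g ∧ l.length = n}.Nonempty)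
  obtain ⟨l', hl', hlt, hprod'⟩ := h.exists_shorter_word hl ha (hprod ▸ hga)
  calc Bruhat.length S (r a * g) ≤ l'.length := Nat.sInf_le ⟨l', hl', hprod ▸ hprod', rfl⟩
    _ < l.length := hlt
    _ = Bruhat.length S g := hlen

theorem exists_pos_of_length_lt (h : PositiveSystem S r Pos) (hS : Subgroup.closure S = ⊤)
    {g t : G} (ht : t ∈ Bruhat.reflections S) (hlt : Bruhat.length S g < Bruhat.length S (g * t)) :
    ∃ a ∈ Pos, g⁻¹ • a ∈ Pos ∧ g * t = r a * g := by
  obtain ⟨k, s, hs, rfl⟩ := ht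
  obtain ⟨a₀, rfl⟩ := h.subset_range hs
  obtain ⟨a, ha, hra⟩ := h.exists_pos ((g * k) • a₀)
  have hmul : g * (k * r a₀ * k⁻¹) = r a * g := by
    rw [hra, h.refl_smul]
    group
  refine ⟨a, ha, ?_, hmul⟩
  by_contra hga
  exact (h.length_refl_mul_lt hS ha hga).asymm (hmul ▸ hlt)

end PositiveSystem

/-! ### Affine roots -/

namespace AffineWeyl

open RootDatum

variable {ι X Y : Type*} [AddCommGroup X] [AddCommGroup Y] {P : RootDatum ι X Y}

theorem coe_refl_apply (i : ι) (y : Y) :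
    (refl P i : Y ≃ₗ[ℤ] Y) y = y - P.root' i y • P.coroot i :=
  RootPairing.coreflection_apply ..

theorem refl_inv (i : ι) : (refl P i)⁻¹ = refl P i := Subtype.ext (P.coreflection_inv i)

theorem root'_refl_apply (i j : ι) (y : Y) :
    P.root' j ((refl P i : Y ≃ₗ[ℤ] Y) y) = P.root' (P.reflectionPerm i j) y :=
  P.flip.coroot'_reflection y

theorem fin_mul_t (w : W P) (y : Y) :
    fin P w * t P y = t P ((w : Y ≃ₗ[ℤ] Y) y) * fin P w :=
  SemidirectProduct.ext
    (Multiplicative.toAdd.injective (by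
      change 0 + (w : Y ≃ₗ[ℤ] Y) y = (w : Y ≃ₗ[ℤ] Y) y + 0
      rw [zero_add, add_zero]))
    (by simp [fin, t])

theorem t_add (y z : Y) : t P (y + z) = t P y * t P z := by
  simp only [t, ofAdd_add, map_mul]

theorem t_mul_fin (g : ExtAffineWeyl P) : t P g.left.toAdd * fin P g.right = g :=
  SemidirectProduct.inl_left_mul_inr_right g

theorem exists_coroot_eq (w : W P) (i : ι) :
    ∃ j, P.coroot j = (w : Y ≃ₗ[ℤ] Y) (P.coroot i) ∧
      ∀ y, P.root' j ((w : Y ≃ₗ[ℤ] Y) y) = P.root' i y := by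
  obtain ⟨w, hw⟩ := w
  have hrefl (k i : ι) : ∃ j, P.coroot j = P.coreflection k (P.coroot i) ∧
      ∀ y, P.root' j (P.coreflection k y) = P.root' i y :=
    ⟨P.reflectionPerm k i, P.coroot_reflectionPerm k i, fun y =>
      (root'_refl_apply k _ y).trans (by rw [P.reflectionPerm_self])⟩
  induction hw using Subgroup.closure_induction'' generalizing i with
  | mem w hw =>
    obtain ⟨k, rfl⟩ := hw
    exact hrefl k i
  | inv_mem w hw =>
    obtain ⟨k, rfl⟩ := hw
    change ∃ j, P.coroot j = (P.coreflection k)⁻¹ (P.coroot i) ∧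
      ∀ y, P.root' j ((P.coreflection k)⁻¹ y) = P.root' i y
    rw [P.coreflection_inv k]
    exact hrefl k i
  | one => exact ⟨i, rfl, fun _ => rfl⟩
  | mul v w _ _ hv hw =>
    obtain ⟨j, hj, hj'⟩ := hw i
    obtain ⟨k, hk, hk'⟩ := hv j
    exact ⟨k, by rw [hk, hj]; rfl, fun y => (hk' _).trans (hj' y)⟩

/-- The index of the root `w(α)`, where `α` is the root with index `i`. -/
def rootIndex (w : W P) (i : ι) : ι := (exists_coroot_eq w i).choose

theorem coroot_rootIndex (w : W P) (i : ι) :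
    P.coroot (rootIndex w i) = (w : Y ≃ₗ[ℤ] Y) (P.coroot i) :=
  (exists_coroot_eq w i).choose_spec.1

theorem root'_rootIndex (w : W P) (i : ι) (y : Y) :
    P.root' (rootIndex w i) ((w : Y ≃ₗ[ℤ] Y) y) = P.root' i y :=
  (exists_coroot_eq w i).choose_spec.2 y

theorem root'_apply_eq_rootIndex_inv (w : W P) (i : ι) (y : Y) :
    P.root' i ((w : Y ≃ₗ[ℤ] Y) y) = P.root' (rootIndex w⁻¹ i) y := by
  simpa using (root'_rootIndex w⁻¹ i ((w : Y ≃ₗ[ℤ] Y) y)).symm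

theorem rootIndex_eq_iff {w : W P} {i j : ι} :
    rootIndex w i = j ↔ P.coroot j = (w : Y ≃ₗ[ℤ] Y) (P.coroot i) := by
  rw [← coroot_rootIndex, eq_comm, P.coroot.injective.eq_iff]

theorem rootIndex_refl (i j : ι) : rootIndex (refl P i) j = P.reflectionPerm i j :=
  rootIndex_eq_iff.2 (P.coroot_reflectionPerm i j)

theorem rootIndex_one (i : ι) : rootIndex (1 : W P) i = i := rootIndex_eq_iff.2 rfl

theorem rootIndex_mul (v w : W P) (i : ι) :
    rootIndex (v * w) i = rootIndex v (rootIndex w i) :=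
  rootIndex_eq_iff.2 (by rw [coroot_rootIndex, coroot_rootIndex]; rfl)

theorem conj_refl (w : W P) (i : ι) : w * refl P i * w⁻¹ = refl P (rootIndex w i) := by
  rw [mul_inv_eq_iff_eq_mul]
  ext y
  change (w : Y ≃ₗ[ℤ] Y) ((refl P i : Y ≃ₗ[ℤ] Y) y) =
    (refl P (rootIndex w i) : Y ≃ₗ[ℤ] Y) ((w : Y ≃ₗ[ℤ] Y) y)
  rw [coe_refl_apply, coe_refl_apply, root'_rootIndex, coroot_rootIndex, map_sub, map_smul]

theorem act_t (y : Y) (v : V Y) : act P (t P y) v = v + (1 : ℝ) ⊗ₜ[ℤ] y :=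
  congrArg (· + (1 : ℝ) ⊗ₜ[ℤ] y) (LinearMap.congr_fun LinearMap.baseChange_id v)

theorem pair_rootIndex (w : W P) (i : ι) (v : V Y) :
    pair P (rootIndex w i) ((w : Y ≃ₗ[ℤ] Y).toLinearMap.baseChange ℝ v) = pair P i v := by
  induction v using TensorProduct.induction_on with
  | zero => simp
  | tmul r y =>
    rw [LinearMap.baseChange_tmul, pair_tmul, pair_tmul, LinearEquiv.coe_coe, root'_rootIndex]
  | add v v' h h' => rw [map_add, map_add, map_add, h, h']

theorem pair_reflectionPerm (i j : ι) (v : V Y) :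
    pair P (P.reflectionPerm i j) v = pair P j v - P.pairing j i * pair P i v := by
  induction v using TensorProduct.induction_on with
  | zero => simp
  | tmul r y =>
    rw [pair_tmul, pair_tmul, pair_tmul, ← root'_refl_apply, coe_refl_apply, map_sub, map_smul,
      P.root'_coroot_eq_pairing]
    push_cast [smul_eq_mul]
    ring
  | add v v' h h' => rw [map_add, map_add, map_add, h, h']; ring

theorem pair_coroot (i j : ι) : pair P i ((1 : ℝ) ⊗ₜ[ℤ] P.coroot j) = P.pairing i j := by
  rw [pair_tmul, one_mul, P.root'_coroot_eq_pairing]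

end AffineWeyl

/-- The affine root `α + k`, where `α` is the root with index `root` and `k = const`, regarded as
the affine function `v ↦ ⟨α, v⟩ + k` on `V`. -/
@[ext]
structure AffineRoot {ι X Y : Type*} [AddCommGroup X] [AddCommGroup Y] (P : RootDatum ι X Y) where
  root : ι
  const : ℤ

namespace AffineRoot

open RootDatum AffineWeyl

variable {ι X Y : Type*} [AddCommGroup X] [AddCommGroup Y] {P : RootDatum ι X Y}

/-- The value of an affine root at a point of `V`. -/
def eval (a : AffineRoot P) (v : V Y) : ℝ := pair P a.root v + a.const

instance : MulAction (ExtAffineWeyl P) (AffineRoot P) where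
  smul g a := ⟨rootIndex g.right a.root,
    a.const - P.root' (rootIndex g.right a.root) g.left.toAdd⟩
  one_smul a := AffineRoot.ext (rootIndex_one _) (by
    change a.const - P.root' _ (0 : Y) = a.const
    simp)
  mul_smul g h a := AffineRoot.ext (rootIndex_mul ..) (by
    change a.const - P.root' (rootIndex (g.right * h.right) a.root)
        (g.left.toAdd + (g.right : Y ≃ₗ[ℤ] Y) h.left.toAdd) =
      a.const - P.root' (rootIndex h.right a.root) h.left.toAdd -
        P.root' (rootIndex g.right (rootIndex h.right a.root)) g.left.toAdd
    rw [rootIndex_mul, map_add, root'_rootIndex]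
    ring)

theorem root_smul (g : ExtAffineWeyl P) (a : AffineRoot P) :
    (g • a).root = rootIndex g.right a.root := rfl

theorem const_smul (g : ExtAffineWeyl P) (a : AffineRoot P) :
    (g • a).const = a.const - P.root' (rootIndex g.right a.root) g.left.toAdd := rfl

theorem eval_smul (g : ExtAffineWeyl P) (a : AffineRoot P) (v : V Y) :
    (g • a).eval (act P g v) = a.eval v := by
  rw [eval, eval, act, map_add, root_smul, const_smul, pair_rootIndex, pair_tmul]
  push_cast
  ring

theorem eval_act (g : ExtAffineWeyl P) (a : AffineRoot P) (v : V Y) :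
    a.eval (act P g v) = (g⁻¹ • a).eval v := by
  rw [← eval_smul g (g⁻¹ • a), smul_inv_smul]

/-- The reflection in the hyperplane on which the affine root vanishes. -/
def reflection (a : AffineRoot P) : affineWeyl P :=
  ⟨t P (-a.const • P.coroot a.root) * fin P (refl P a.root), by
    change -a.const • P.coroot a.root + 0 ∈ corootLattice P
    rw [add_zero]
    exact zsmul_mem (AddSubgroup.subset_closure (Set.mem_range_self _)) _⟩

theorem coe_reflection (a : AffineRoot P) :
    (a.reflection : ExtAffineWeyl P) = t P (-a.const • P.coroot a.root) * fin P (refl P a.root) :=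
  rfl

theorem act_reflection (a : AffineRoot P) (v : V Y) :
    act P a.reflection v = v - a.eval v • ((1 : ℝ) ⊗ₜ[ℤ] P.coroot a.root) := by
  have hrefl : (refl P a.root : Y ≃ₗ[ℤ] Y).toLinearMap.baseChange ℝ v =
      v - pair P a.root v • ((1 : ℝ) ⊗ₜ[ℤ] P.coroot a.root) := by
    induction v using TensorProduct.induction_on with
    | zero => simp
    | tmul r y =>
      rw [LinearMap.baseChange_tmul, LinearEquiv.coe_coe, coe_refl_apply, pair_tmul,
        TensorProduct.tmul_sub, TensorProduct.tmul_smul, mul_comm, mul_smul, Int.cast_smul_eq_zsmul,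
        TensorProduct.smul_tmul' r, smul_eq_mul, mul_one]
    | add v v' h h' => rw [map_add, map_add, h, h']; module
  change (1 * refl P a.root : W P).1.toLinearMap.baseChange ℝ v +
    (1 : ℝ) ⊗ₜ[ℤ] (-a.const • P.coroot a.root + (0 : Y)) = _
  rw [one_mul, hrefl, eval, add_zero, TensorProduct.tmul_smul, ← Int.cast_smul_eq_zsmul ℝ]
  push_cast
  module

theorem coe_reflection_smul (g : ExtAffineWeyl P) (a : AffineRoot P) :
    ((g • a).reflection : ExtAffineWeyl P) = g * a.reflection * g⁻¹ := by
  rw [eq_mul_inv_iff_mul_eq]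
  refine SemidirectProduct.ext (Multiplicative.toAdd.injective ?_) ?_
  · change -(g • a).const • P.coroot (g • a).root + (0 : Y) +
        (1 * refl P (g • a).root : W P).1 g.left.toAdd =
      g.left.toAdd + (g.right : Y ≃ₗ[ℤ] Y) (-a.const • P.coroot a.root + (0 : Y))
    rw [add_zero, add_zero, one_mul, map_smul, coe_refl_apply, const_smul, root_smul,
      coroot_rootIndex]
    module
  · change 1 * refl P (rootIndex g.right a.root) * g.right = g.right * (1 * refl P a.root)
    rw [one_mul, one_mul, ← conj_refl, inv_mul_cancel_right]

theorem reflection_mul_self (a : AffineRoot P) : a.reflection * a.reflection = 1 := by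
  refine Subtype.ext ?_
  rw [Subgroup.coe_mul, coe_reflection, mul_assoc, ← mul_assoc (fin P _), fin_mul_t, mul_assoc,
    ← map_mul, ← mul_assoc, ← t_add, coe_refl_apply, map_smul,
    P.root'_coroot_eq_pairing, P.pairing_same]
  nth_rw 1 [← refl_inv]
  rw [inv_mul_cancel, map_one, mul_one]
  rw [show -a.const • P.coroot a.root + (-a.const • P.coroot a.root -
    (-a.const • (2 : ℤ)) • P.coroot a.root) = 0 by module]
  exact map_one SemidirectProduct.inl

theorem reflection_smul (g : affineWeyl P) (a : AffineRoot P) :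
    (g • a).reflection = g * a.reflection * g⁻¹ := by
  refine Subtype.ext ?_
  rw [Subgroup.smul_def, coe_reflection_smul, Subgroup.coe_mul, Subgroup.coe_mul, Subgroup.coe_inv]

theorem reflection_reflection_smul_self (a : AffineRoot P) :
    (a.reflection • a).reflection = a.reflection := by
  rw [reflection_smul, mul_inv_cancel_right]

theorem root_reflection_smul (a c : AffineRoot P) :
    (a.reflection • c).root = P.reflectionPerm a.root c.root := by
  change rootIndex (1 * refl P a.root) c.root = _
  rw [one_mul, rootIndex_refl]

theorem const_reflection_smul (a c : AffineRoot P) :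
    (a.reflection • c).const = c.const - P.pairing c.root a.root * a.const := by
  change c.const - P.root' (rootIndex (1 * refl P a.root) c.root)
    (-a.const • P.coroot a.root + (0 : Y)) = _
  rw [one_mul, rootIndex_refl, add_zero, map_smul, P.root'_coroot_eq_pairing,
    ← P.pairing_reflectionPerm, P.pairing_reflectionPerm_self_right, smul_eq_mul]
  ring

end AffineRoot

/-! ### Positive affine roots -/

namespace AffineWeyl

open RootDatum

variable {ι X Y : Type*} [AddCommGroup X] [AddCommGroup Y] {P : RootDatum ι X Y} {b : P.Base}
  {θ : ι}

theorem height_reflectionPerm (i j : ι) :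
    b.height (P.reflectionPerm i j) = b.height j - P.pairing j i * b.height i := by
  have hroot : P.root (P.reflectionPerm i j) = P.root j + (-P.pairing j i) • P.root i := by
    rw [P.root_reflectionPerm, P.reflection_apply_root, neg_smul, sub_eq_add_neg]
  rw [b.height_add_zsmul hroot, smul_eq_mul]
  ring

theorem height_neg (i : ι) : b.height (P.reflectionPerm i i) = -b.height i :=
  b.height_reflectionPerm_self i

theorem neg_neg_index (i : ι) :
    P.reflectionPerm (P.reflectionPerm i i) (P.reflectionPerm i i) = i :=
  P.indexNeg.neg_neg i

theorem exists_root_eq_add_sum (hθ : IsHighest b θ) (j : ι) :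
    ∃ f : ι → ℕ, P.root θ = P.root j + ∑ k ∈ b.support, f k • P.root k := by
  classical
  have h := hθ j
  rw [← Finset.coe_image, AddSubmonoid.mem_closure_finset] at h
  obtain ⟨f, -, hf⟩ := h
  rw [Finset.sum_image P.root.injective.injOn] at hf
  exact ⟨fun k => f (P.root k), by rw [hf, add_sub_cancel]⟩

theorem exists_height_eq_add_sum (hθ : IsHighest b θ) (j : ι) :
    ∃ f : ι → ℕ, P.root θ = P.root j + ∑ k ∈ b.support, f k • P.root k ∧
      b.height θ = b.height j + (∑ k ∈ b.support, f k : ℕ) := by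
  obtain ⟨f, hf⟩ := exists_root_eq_add_sum hθ j
  obtain ⟨g, -, -, hg⟩ := b.exists_root_eq_sum_int j
  refine ⟨f, hf, ?_⟩
  have hfg : P.root θ = ∑ k ∈ b.support, (g k + f k) • P.root k := by
    simp only [add_smul, Finset.sum_add_distrib, natCast_zsmul, hf, hg]
  rw [b.height_eq_sum hfg, b.height_eq_sum hg, Finset.sum_add_distrib,
    Nat.cast_sum]

theorem height_le (hθ : IsHighest b θ) (j : ι) : b.height j ≤ b.height θ := by
  obtain ⟨f, -, hf⟩ := exists_height_eq_add_sum hθ j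
  lia

theorem eq_of_height_le (hθ : IsHighest b θ) {j : ι} (hj : b.height θ ≤ b.height j) : j = θ := by
  obtain ⟨f, hroot, hf⟩ := exists_height_eq_add_sum hθ j
  have hsum : ∑ k ∈ b.support, f k = 0 := by lia
  rw [Finset.sum_eq_zero_iff] at hsum
  rw [Finset.sum_eq_zero fun k hk => by rw [hsum k hk, zero_smul], add_zero] at hroot
  exact (P.root.injective hroot).symm

theorem height_highest_pos (hθ : IsHighest b θ) : 0 < b.height θ := by
  have h := height_le hθ (P.reflectionPerm θ θ)
  rw [height_neg] at h
  have := b.height_ne_zero θ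
  lia

theorem neg_height_lt (hθ : IsHighest b θ) {n : ι} (hn : n ≠ P.reflectionPerm θ θ) :
    -b.height θ < b.height n := by
  by_contra! h
  have hneg : b.height θ ≤ b.height (P.reflectionPerm n n) := by rw [height_neg]; lia
  exact hn (by rw [← eq_of_height_le hθ hneg, neg_neg_index])

theorem pairing_highest_le_one (hθ : IsHighest b θ) {n : ι} (hn : n ≠ θ) :
    P.pairing n θ ≤ 1 := by
  have hlt : b.height n < b.height θ := lt_of_not_ge fun h => hn (eq_of_height_le hθ h)
  have h := height_le hθ (P.reflectionPerm (P.reflectionPerm θ n) (P.reflectionPerm θ n))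
  rw [height_neg, height_reflectionPerm] at h
  by_contra! hc
  nlinarith [height_highest_pos hθ]

theorem neg_one_le_pairing_highest (hθ : IsHighest b θ) {n : ι} (hn : n ≠ P.reflectionPerm θ θ) :
    -1 ≤ P.pairing n θ := by
  have h := pairing_highest_le_one hθ (n := P.reflectionPerm n n)
    (by rintro rfl; exact hn (neg_neg_index n).symm)
  rw [P.pairing_reflectionPerm_self_left] at h
  lia

theorem pairing_highest_nonneg (hθ : IsHighest b θ) {n : ι} (hn : b.IsPos n) :
    0 ≤ P.pairing n θ := by
  have h := height_le hθ (P.reflectionPerm θ n)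
  rw [height_reflectionPerm] at h
  rw [b.isPos_iff] at hn
  by_contra! hc
  nlinarith [height_highest_pos hθ]

end AffineWeyl

namespace AffineRoot

open RootDatum AffineWeyl

variable {ι X Y : Type*} [AddCommGroup X] [AddCommGroup Y] {P : RootDatum ι X Y}

/-- The positive affine roots, that is, those taking positive values on the base alcove. -/
def IsPositive (b : P.Base) (a : AffineRoot P) : Prop :=
  0 < a.const ∨ a.const = 0 ∧ b.IsPos a.root

variable {b : P.Base} {θ : ι}

theorem isPositive_or_isPositive_reflection_smul (b : P.Base) (a : AffineRoot P) :
    IsPositive b a ∨ IsPositive b (a.reflection • a) := by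
  rw [IsPositive, IsPositive, root_reflection_smul, const_reflection_smul, P.pairing_same,
    b.isPos_iff, b.isPos_iff, height_neg]
  have := b.height_ne_zero a.root
  lia

theorem coe_reflection_zero (i : ι) :
    ((reflection ⟨i, 0⟩ : affineWeyl P) : ExtAffineWeyl P) = fin P (refl P i) := by
  rw [coe_reflection, neg_zero, zero_smul]
  exact one_mul _

theorem coe_reflection_neg_one (i : ι) :
    ((reflection ⟨i, -1⟩ : affineWeyl P) : ExtAffineWeyl P) =
      t P (P.coroot i) * fin P (refl P i) := by
  rw [coe_reflection, neg_neg, one_smul]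

theorem mem_simpleReflections_iff {y : affineWeyl P} :
    y ∈ simpleReflections b ↔ (∃ i ∈ b.support, y = reflection ⟨i, 0⟩) ∨
      ∃ θ, IsHighest b θ ∧ y = reflection ⟨θ, -1⟩ := by
  simp only [simpleReflections, Set.mem_ofPred_eq, Subtype.ext_iff, coe_reflection_zero,
    coe_reflection_neg_one]

theorem IsPositive.simple_reflection_smul [Finite ι] [P.IsReduced] {a : AffineRoot P}
    (ha : IsPositive b a) {i : ι} (hi : i ∈ b.support)
    (hai : reflection ⟨i, 0⟩ ≠ a.reflection) :
    IsPositive b ((reflection ⟨i, 0⟩ : affineWeyl P) • a) := by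
  rw [IsPositive, root_reflection_smul, const_reflection_smul, mul_zero, sub_zero]
  refine ha.imp_right fun ⟨h₀, hpos⟩ => ⟨h₀, hpos.reflectionPerm hi ?_⟩
  rintro rfl
  exact hai (congrArg reflection (AffineRoot.ext rfl h₀.symm))

theorem IsPositive.highest_reflection_smul {a : AffineRoot P} (hθ : IsHighest b θ)
    (ha : IsPositive b a) (haθ : reflection ⟨θ, -1⟩ ≠ a.reflection) :
    IsPositive b ((reflection ⟨θ, -1⟩ : affineWeyl P) • a) := by
  have hhigh := height_highest_pos hθ
  by_cases hneg : a.root = P.reflectionPerm θ θ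
  · have hne : a.const ≠ 1 := fun h => haθ <| by
      rw [← reflection_reflection_smul_self ⟨θ, -1⟩]
      congr 1
      ext
      · rw [root_reflection_smul, hneg]
      · rw [const_reflection_smul, P.pairing_same, h]
        norm_num
    rw [IsPositive, b.isPos_iff, hneg, height_neg] at ha
    rw [IsPositive, b.isPos_iff, root_reflection_smul, const_reflection_smul,
      height_reflectionPerm, hneg, height_neg, P.pairing_reflectionPerm_self_left, P.pairing_same]
    lia
  · have hlow := neg_height_lt hθ hneg
    have hpair := neg_one_le_pairing_highest hθ hneg
    have hnonneg := pairing_highest_nonneg hθ (n := a.root)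
    rw [b.isPos_iff] at hnonneg
    rw [IsPositive, b.isPos_iff] at ha
    rw [IsPositive, b.isPos_iff, root_reflection_smul, const_reflection_smul,
      height_reflectionPerm]
    rcases hpair.eq_or_lt with h | h
    · rw [← h]
      lia
    rcases (Int.lt_iff_add_one_le.1 h).eq_or_lt with h | h
    · rw [← h]
      lia
    · lia

theorem positiveSystem [Finite ι] [P.IsReduced] (b : P.Base) :
    PositiveSystem (simpleReflections b) reflection {a : AffineRoot P | IsPositive b a} where
  refl_smul := reflection_smul
  refl_mul_self := reflection_mul_self
  exists_pos a := (isPositive_or_isPositive_reflection_smul b a).elim (fun h => ⟨a, h, rfl⟩)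
    fun h => ⟨_, h, reflection_reflection_smul_self a⟩
  subset_range y hy := by
    obtain ⟨i, -, rfl⟩ | ⟨θ, -, rfl⟩ := mem_simpleReflections_iff.1 hy <;>
    exact Set.mem_range_self _
  refl_eq_of_smul_notMem {s} hs {a} ha hsa := by
    by_contra hne
    obtain ⟨i, hi, rfl⟩ | ⟨θ, hθ, rfl⟩ := mem_simpleReflections_iff.1 hs
    · exact hsa (IsPositive.simple_reflection_smul ha hi (Ne.symm hne))
    · exact hsa (IsPositive.highest_reflection_smul hθ ha (Ne.symm hne))

end AffineRoot

/-! ### The closed alcove -/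

namespace AffineWeyl

open RootDatum

variable {ι X Y : Type*} [AddCommGroup X] [AddCommGroup Y] {P : RootDatum ι X Y} {b : P.Base}
  {θ : ι}

variable (P) in
/-- The linear form `⟨x, ·⟩` on `V` given by `x ∈ X^*`; it extends `RootDatum.pair` linearly from
the roots to the character lattice. -/
def realPairing : X →ₗ[ℤ] Module.Dual ℝ (V Y) := Module.Dual.baseChange ℝ ∘ₗ P.toLinearMap

theorem realPairing_root (i : ι) : realPairing P (P.root i) = pair P i := rfl

theorem pair_eq_add {i j k : ι} (h : P.root k = P.root i + P.root j) (v : V Y) :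
    pair P k v = pair P i v + pair P j v := by
  rw [← realPairing_root, h, map_add, LinearMap.add_apply, realPairing_root, realPairing_root]

theorem pair_neg (i : ι) (v : V Y) : pair P (P.reflectionPerm i i) v = -pair P i v := by
  rw [pair_reflectionPerm, P.pairing_same]
  norm_num
  ring

theorem exists_pair_simple_le [Finite ι] {v : V Y} (hv : ∀ j ∈ b.support, 0 ≤ pair P j v) {i : ι}
    (hi : b.IsPos i) : ∃ j ∈ b.support, pair P j v ≤ pair P i v := by
  refine hi.induction_on_add (p := fun i => ∃ j ∈ b.support, pair P j v ≤ pair P i v)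
    (fun i hi => ⟨i, hi, le_rfl⟩) fun i j k hk ⟨l, hl, hle⟩ hj => ?_
  exact ⟨l, hl, by rw [pair_eq_add hk]; linarith [hv j hj]⟩

theorem pair_le_pair_highest (hθ : IsHighest b θ) {v : V Y}
    (hv : ∀ j ∈ b.support, 0 ≤ pair P j v) (i : ι) : pair P i v ≤ pair P θ v := by
  obtain ⟨f, hf⟩ := exists_root_eq_add_sum hθ i
  rw [← realPairing_root θ, hf, map_add, map_sum, LinearMap.add_apply, LinearMap.sum_apply,
    realPairing_root]
  refine le_add_of_nonneg_right (Finset.sum_nonneg fun k hk => ?_)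
  rw [map_nsmul, LinearMap.smul_apply, realPairing_root]
  exact nsmul_nonneg (hv k hk) _

theorem nonneg_of_mem_closedAlcove (hθ : IsHighest b θ) {v : V Y} (hv : v ∈ closedAlcove b) :
    (∀ i ∈ b.support, 0 ≤ pair P i v) ∧ pair P θ v ≤ 1 := by
  let _ : TopologicalSpace (V Y) := moduleTopology ℝ (V Y)
  have : IsModuleTopology ℝ (V Y) := ⟨rfl⟩
  have hc (i : ι) : Continuous (pair P i) := IsModuleTopology.continuous_of_linearMap _
  have hclosed : IsClosed {v : V Y | (∀ i ∈ b.support, 0 ≤ pair P i v) ∧ pair P θ v ≤ 1} := by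
    simp only [Set.ofPred_and, Set.ofPred_forall]
    exact (isClosed_biInter fun i _ => isClosed_le continuous_const (hc i)).inter
      (isClosed_le (hc θ) continuous_const)
  have hsub : alcove b ⊆ {v | (∀ i ∈ b.support, 0 ≤ pair P i v) ∧ pair P θ v ≤ 1} :=
    fun u hu => ⟨fun i hi => (hu.1 i hi).le, (hu.2 θ hθ).le⟩
  exact closure_minimal hsub hclosed hv

end AffineWeyl

namespace AffineRoot

open RootDatum AffineWeyl

variable {ι X Y : Type*} [AddCommGroup X] [AddCommGroup Y] {P : RootDatum ι X Y} {b : P.Base}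
  {θ : ι} {a : AffineRoot P} {v : V Y}

theorem eval_reflection_smul_self (a : AffineRoot P) (v : V Y) :
    (a.reflection • a).eval v = -a.eval v := by
  rw [eval, eval, root_reflection_smul, const_reflection_smul, pair_neg, P.pairing_same]
  push_cast
  ring

theorem IsPositive.wall_le_eval [Finite ι] (hθ : IsHighest b θ) (ha : IsPositive b a)
    (hv : ∀ j ∈ b.support, 0 ≤ pair P j v) :
    (∃ j ∈ b.support, pair P j v ≤ a.eval v) ∨ 1 - pair P θ v ≤ a.eval v := by
  obtain hpos | ⟨hzero, hroot⟩ := ha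
  · right
    have hneg := pair_le_pair_highest hθ hv (P.reflectionPerm a.root a.root)
    rw [pair_neg] at hneg
    have hconst : (1 : ℝ) ≤ a.const := by exact_mod_cast hpos
    rw [eval]
    linarith
  · left
    obtain ⟨j, hj, hle⟩ := exists_pair_simple_le hv hroot
    exact ⟨j, hj, by rwa [eval, hzero, Int.cast_zero, add_zero]⟩

theorem IsPositive.eval_nonneg [Finite ι] (hθ : IsHighest b θ) (ha : IsPositive b a)
    (hv : ∀ j ∈ b.support, 0 ≤ pair P j v) (hvθ : pair P θ v ≤ 1) : 0 ≤ a.eval v := by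
  obtain ⟨j, hj, hle⟩ | hle := ha.wall_le_eval hθ hv
  · exact (hv j hj).trans hle
  · linarith

theorem IsPositive.eval_pos [Finite ι] (hθ : IsHighest b θ) (ha : IsPositive b a)
    (hv : v ∈ alcove b) : 0 < a.eval v := by
  obtain ⟨j, hj, hle⟩ | hle := ha.wall_le_eval hθ fun j hj => (hv.1 j hj).le
  · exact (hv.1 j hj).trans_le hle
  · linarith [hv.2 θ hθ]

theorem isPositive_iff_eval_pos [Finite ι] (hθ : IsHighest b θ) (hv : v ∈ alcove b) :
    IsPositive b a ↔ 0 < a.eval v := by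
  refine ⟨fun ha => ha.eval_pos hθ hv, fun hpos => ?_⟩
  refine (isPositive_or_isPositive_reflection_smul b a).resolve_right fun hneg => ?_
  have := hneg.eval_pos hθ hv
  rw [eval_reflection_smul_self] at this
  linarith

theorem mem_alcove_iff [Finite ι] (hθ : IsHighest b θ) :
    v ∈ alcove b ↔ ∀ a : AffineRoot P, IsPositive b a → 0 < a.eval v := by
  refine ⟨fun hv a ha => ha.eval_pos hθ hv, fun h => ⟨fun i hi => ?_, fun η _ => ?_⟩⟩
  · simpa [eval] using h ⟨i, 0⟩ (.inr ⟨rfl, RootPairing.Base.isPos_of_mem_support hi⟩)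
  · have := h ⟨P.reflectionPerm η η, 1⟩ (.inl zero_lt_one)
    rw [eval, pair_neg, Int.cast_one] at this
    linarith

theorem mem_stab_of_mem_alcove [Finite ι] (hθ : IsHighest b θ) {g : ExtAffineWeyl P}
    (hv : v ∈ alcove b) (hgv : act P g v ∈ alcove b) : g ∈ stab b := by
  have hpos (a : AffineRoot P) : IsPositive b (g • a) ↔ IsPositive b a := by
    rw [isPositive_iff_eval_pos (a := g • a) hθ hgv, eval_smul, isPositive_iff_eval_pos hθ hv]
  have hmem (u : V Y) : act P g u ∈ alcove b ↔ u ∈ alcove b := by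
    rw [mem_alcove_iff hθ, mem_alcove_iff hθ, (MulAction.surjective g).forall]
    simp only [hpos, eval_smul]
  refine Set.Subset.antisymm (Set.image_subset_iff.2 fun u => (hmem u).2) fun u hu => ?_
  have hu' : act P g (act P g⁻¹ u) = u := by rw [← act_mul, mul_inv_cancel, act_one]
  exact ⟨act P g⁻¹ u, (hmem _).1 (by rwa [hu']), hu'⟩

theorem IsPositive.inv_smul_of_mem_stab [Finite ι] (hθ : IsHighest b θ)
    (hne : (alcove b).Nonempty) {ω : ExtAffineWeyl P} (hω : ω ∈ stab b) (ha : IsPositive b a) :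
    IsPositive b (ω⁻¹ • a) := by
  obtain ⟨v, hv⟩ := hne
  rw [isPositive_iff_eval_pos hθ hv, ← eval_act]
  exact ha.eval_pos hθ (hω ▸ Set.mem_image_of_mem _ hv)

end AffineRoot

namespace AffineWeyl

open RootDatum

variable {ι X Y : Type*} [AddCommGroup X] [AddCommGroup Y] {P : RootDatum ι X Y} {b : P.Base}
  {θ : ι}

theorem pairing_pos_comm [Finite ι] {i j : ι} : 0 < P.pairing i j ↔ 0 < P.pairing j i := by
  rw [← P.algebraMap_pairingIn ℤ i j, ← P.algebraMap_pairingIn ℤ j i]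
  exact P.zero_lt_pairingIn_iff' ℤ

theorem pairing_nonneg_comm [Finite ι] {i j : ι} : 0 ≤ P.pairing i j ↔ 0 ≤ P.pairing j i := by
  have h := pairing_pos_comm (P := P) (i := i) (j := P.reflectionPerm j j)
  rw [P.pairing_reflectionPerm_self_left, P.pairing_reflectionPerm_self_right] at h
  lia

theorem pairing_highest_pos [Finite ι] (hθ : IsHighest b θ) {n : ι}
    (hn : ∀ j ∈ b.support, 0 ≤ P.pairing n j) : 0 < P.pairing n θ := by
  have hle := pair_le_pair_highest hθ (v := (1 : ℝ) ⊗ₜ[ℤ] P.coroot n) (fun j hj => by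
    rw [pair_coroot]
    exact_mod_cast pairing_nonneg_comm.1 (hn j hj)) n
  rw [pair_coroot, pair_coroot, P.pairing_same] at hle
  have hle' : (2 : ℤ) ≤ P.pairing θ n := by exact_mod_cast hle
  exact pairing_pos_comm.1 (by lia)

theorem exists_pairing_pos_or_pairing_highest_neg [Finite ι] (hθ : IsHighest b θ) (i : ι) :
    (∃ j ∈ b.support, 0 < P.pairing i j) ∨ P.pairing i θ < 0 := by
  by_contra! h
  have hneg := pairing_highest_pos hθ (n := P.reflectionPerm i i) fun j hj => by
    rw [P.pairing_reflectionPerm_self_left]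
    exact neg_nonneg.2 (h.1 j hj)
  rw [P.pairing_reflectionPerm_self_left] at hneg
  exact absurd h.2 (by lia)

end AffineWeyl

namespace AffineRoot

open RootDatum AffineWeyl

variable {ι X Y : Type*} [AddCommGroup X] [AddCommGroup Y] {P : RootDatum ι X Y} {b : P.Base}
  {θ : ι}

theorem IsPositive.exists_lowering [Finite ι] [P.IsReduced] (hθ : IsHighest b θ) {a : AffineRoot P}
    (ha : IsPositive b a) :
    a.reflection ∈ simpleReflections b ∨ ∃ y ∈ simpleReflections b, IsPositive b (y • a) ∧
      b.height (y • a).root + (b.height θ + 1) * (y • a).const <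
        b.height a.root + (b.height θ + 1) * a.const := by
  rw [or_iff_not_imp_left]
  intro hsimple
  obtain ⟨j, hj, hpos⟩ | hneg := exists_pairing_pos_or_pairing_highest_neg hθ a.root
  · have hmem : reflection ⟨j, 0⟩ ∈ simpleReflections b :=
      mem_simpleReflections_iff.2 (.inl ⟨j, hj, rfl⟩)
    refine ⟨_, hmem, ha.simple_reflection_smul hj fun h => hsimple (h ▸ hmem), ?_⟩
    rw [root_reflection_smul, const_reflection_smul, height_reflectionPerm,
      RootPairing.Base.height_one_of_mem_support hj]
    lia
  · have hmem : reflection ⟨θ, -1⟩ ∈ simpleReflections b :=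
      mem_simpleReflections_iff.2 (.inr ⟨θ, hθ, rfl⟩)
    refine ⟨_, hmem, ha.highest_reflection_smul hθ fun h => hsimple (h ▸ hmem), ?_⟩
    rw [root_reflection_smul, const_reflection_smul, height_reflectionPerm]
    linarith

theorem IsPositive.height_pos (hθ : IsHighest b θ) {a : AffineRoot P} (ha : IsPositive b a) :
    0 < b.height a.root + (b.height θ + 1) * a.const := by
  obtain hconst | ⟨hzero, hroot⟩ := ha
  · have hneg := height_le hθ (P.reflectionPerm a.root a.root)
    rw [height_neg] at hneg
    nlinarith [height_highest_pos hθ]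
  · rwa [hzero, mul_zero, add_zero]

theorem reflection_mem_closure [Finite ι] [P.IsReduced] (hθ : IsHighest b θ) (a : AffineRoot P) :
    a.reflection ∈ Subgroup.closure (simpleReflections b) := by
  suffices h : ∀ a : AffineRoot P, IsPositive b a →
      a.reflection ∈ Subgroup.closure (simpleReflections b) by
    obtain ha | ha := isPositive_or_isPositive_reflection_smul b a
    · exact h a ha
    · exact reflection_reflection_smul_self a ▸ h _ ha
  intro a ha
  induction hN : (b.height a.root + (b.height θ + 1) * a.const).toNat
    using Nat.strong_induction_on generalizing a with
  | h N ih =>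
    obtain hsimple | ⟨y, hy, hpos, hlt⟩ := ha.exists_lowering hθ
    · exact Subgroup.subset_closure hsimple
    have hy' := Subgroup.subset_closure hy
    have hmem := ih _ (by have := hpos.height_pos hθ; lia) _ hpos rfl
    rw [reflection_smul] at hmem
    simpa [mul_assoc] using mul_mem (mul_mem (inv_mem hy') hmem) hy'

theorem closure_simpleReflections [Finite ι] [P.IsReduced] (hθ : IsHighest b θ) :
    Subgroup.closure (simpleReflections b) = ⊤ := by
  let K := (Subgroup.closure (simpleReflections b)).map (affineWeyl P).subtype
  have hrefl (a : AffineRoot P) : (a.reflection : ExtAffineWeyl P) ∈ K :=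
    Subgroup.mem_map_of_mem _ (reflection_mem_closure hθ a)
  have hfin (w : W P) : fin P w ∈ K := by
    have hle : Subgroup.closure ((↑) ⁻¹' Set.range P.coreflection) ≤ K.comap (fin P) := by
      rw [Subgroup.closure_le]
      rintro w ⟨i, hi⟩
      obtain rfl : refl P i = w := Subtype.ext hi
      have hmem := hrefl ⟨i, 0⟩
      rwa [coe_reflection_zero] at hmem
    exact (Subgroup.closure_closure_coe_preimage.symm.trans_le hle) (Subgroup.mem_top w)
  have htrans {y : Y} (hy : y ∈ corootLattice P) : t P y ∈ K := by
    induction hy using AddSubgroup.closure_induction with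
    | mem y hy =>
      obtain ⟨i, rfl⟩ := hy
      have hmul := mul_mem (hrefl ⟨i, -1⟩) (hrefl ⟨i, 0⟩)
      have hsq : refl P i * refl P i = 1 := mul_eq_one_iff_inv_eq.2 (refl_inv i)
      rwa [coe_reflection_neg_one, coe_reflection_zero, mul_assoc, ← map_mul, hsq, map_one,
        mul_one] at hmul
    | zero => exact K.one_mem
    | add y z _ _ hy hz => exact t_add (P := P) y z ▸ mul_mem hy hz
    | neg y _ hy => exact inv_mem hy
  refine eq_top_iff.2 fun y _ => ?_
  obtain ⟨z, hz, hzy⟩ := t_mul_fin (y : ExtAffineWeyl P) ▸ mul_mem (htrans y.2) (hfin _)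
  exact Subtype.ext hzy ▸ hz

end AffineRoot

/-! ### Upward closed sets -/

namespace AffineWeyl

open RootDatum AffineRoot

variable {ι X Y : Type*} [AddCommGroup X] [AddCommGroup Y] {P : RootDatum ι X Y} {b : P.Base}
  {θ : ι}

/-- A set of points of `V` that contains, with a point on the positive side of the hyperplane of a
positive affine root, also the image of the point under the reflection in this hyperplane. Such a
set is stable under the upward steps of the Bruhat order, applied to a point of the closed base
alcove. -/
def IsUpwardClosed (b : P.Base) (A : Set (V Y)) : Prop :=
  ∀ p ∈ A, ∀ a : AffineRoot P, IsPositive b a → 0 < a.eval p → act P a.reflection p ∈ A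

theorem IsUpwardClosed.act_mem_of_bruhatLE [Finite ι] [P.IsReduced] {A : Set (V Y)}
    (hA : IsUpwardClosed b A) (hθ : IsHighest b θ) (hne : (alcove b).Nonempty) {v : V Y}
    (hv₀ : ∀ i ∈ b.support, 0 ≤ pair P i v) (hvθ : pair P θ v ≤ 1) {g h : ExtAffineWeyl P}
    (hgh : bruhatLE b g h) (hg : act P g v ∈ A) : act P h v ∈ A := by
  obtain ⟨y, y', ω, hω, rfl, rfl, hle⟩ := hgh
  induction hle with
  | refl => exact hg
  | @tail u _ _ hstep ih =>
    obtain ⟨r, hr, rfl, hlt⟩ := hstep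
    obtain ⟨a, ha, hua, hmul⟩ :=
      (positiveSystem b).exists_pos_of_length_lt (closure_simpleReflections hθ) hr hlt
    rw [hmul, Subgroup.coe_mul, mul_assoc, act_mul]
    have hnonneg : 0 ≤ a.eval (act P (u * ω) v) := by
      rw [eval_act, mul_inv_rev, mul_smul]
      exact (IsPositive.inv_smul_of_mem_stab hθ hne hω hua).eval_nonneg hθ hv₀ hvθ
    obtain hzero | hpos := hnonneg.eq_or_lt
    · rwa [act_reflection, ← hzero, zero_smul, sub_zero]
    · exact hA _ ih a ha hpos

/-- The points whose difference to `v` pairs with some root to more than `c`. -/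
def farPoints (P : RootDatum ι X Y) (v : V Y) (c : ℝ) : Set (V Y) := {p | ∃ i, c < pair P i (p - v)}

theorem isUpwardClosed_farPoints [Finite ι] (hθ : IsHighest b θ) {v : V Y}
    (hv₀ : ∀ i ∈ b.support, 0 ≤ pair P i v) (hvθ : pair P θ v ≤ 1) (c : ℝ) :
    IsUpwardClosed b (farPoints P v c) := by
  rintro p ⟨i, hi⟩ a ha hpos
  have hav := ha.eval_nonneg hθ hv₀ hvθ
  have hpair (j : ι) : pair P j (act P a.reflection p - v) =
      pair P j (p - v) - a.eval p * P.pairing j a.root := by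
    rw [act_reflection, sub_right_comm, map_sub, map_smul, pair_coroot, smul_eq_mul]
  obtain hle | hlt := le_or_gt (P.pairing i a.root) 0
  · refine ⟨i, ?_⟩
    rw [hpair]
    have : (P.pairing i a.root : ℝ) ≤ 0 := by exact_mod_cast hle
    nlinarith
  · refine ⟨P.reflectionPerm a.root i, ?_⟩
    have hpairing : (0 : ℝ) < P.pairing i a.root := by exact_mod_cast hlt
    have hdiff : a.eval p - pair P a.root (p - v) = a.eval v := by
      rw [eval, eval, map_sub]
      ring
    rw [hpair, pair_reflectionPerm, ← P.pairing_reflectionPerm,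
      P.pairing_reflectionPerm_self_right]
    push_cast
    nlinarith

theorem smul_sub_mem_corootLattice (w : W P) (y : Y) :
    (w : Y ≃ₗ[ℤ] Y) y - y ∈ corootLattice P := by
  obtain ⟨w, hw⟩ := w
  have hrefl (i : ι) (y : Y) : P.coreflection i y - y ∈ corootLattice P := by
    rw [RootPairing.coreflection_apply, sub_sub_cancel_left]
    exact neg_mem (zsmul_mem (AddSubgroup.subset_closure (Set.mem_range_self _)) _)
  change w y - y ∈ corootLattice P
  induction hw using Subgroup.closure_induction'' generalizing y with
  | mem w hw =>
    obtain ⟨i, rfl⟩ := hw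
    exact hrefl i y
  | inv_mem w hw =>
    obtain ⟨i, rfl⟩ := hw
    exact P.coreflection_inv i ▸ hrefl i y
  | one => exact (sub_self y).symm ▸ zero_mem _
  | mul w₁ w₂ _ _ h₁ h₂ => exact sub_add_sub_cancel (w₁ (w₂ y)) (w₂ y) y ▸ add_mem (h₁ _) (h₂ y)

theorem mul_inv_mem_affineWeyl {g h : ExtAffineWeyl P}
    (hgh : (g.left.toAdd : Y) - h.left.toAdd ∈ corootLattice P) : g * h⁻¹ ∈ affineWeyl P := by
  let w : W P := g.right * h.right⁻¹
  have hleft : ((g * h⁻¹).left.toAdd : Y) = g.left.toAdd - (w : Y ≃ₗ[ℤ] Y) h.left.toAdd := by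
    rw [sub_eq_add_neg, ← map_neg]
    rfl
  change ((g * h⁻¹).left.toAdd : Y) ∈ corootLattice P
  rw [hleft, ← sub_sub_sub_cancel_right _ _ (h.left.toAdd : Y)]
  exact sub_mem hgh (smul_sub_mem_corootLattice w _)

theorem isMinuscule_smul {y : Y} (hy : IsMinuscule P y) (w : W P) :
    IsMinuscule P ((w : Y ≃ₗ[ℤ] Y) y) := fun i => by
  rw [root'_apply_eq_rootIndex_inv]
  exact hy _

theorem Adm_smul (b : P.Base) (w : W P) (y : Y) : Adm b ((w : Y ≃ₗ[ℤ] Y) y) = Adm b y :=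
  Set.ext fun _ => (Equiv.mulRight w).exists_congr fun _ => Iff.rfl

theorem hull_smul (w : W P) (y : Y) : hull P ((w : Y ≃ₗ[ℤ] Y) y) = hull P y :=
  congrArg (convexHull ℝ) <| Set.ext fun _ => (Equiv.mulRight w).exists_congr fun _ => Iff.rfl

theorem Perm_smul (b : P.Base) (w : W P) (y : Y) : Perm b ((w : Y ≃ₗ[ℤ] Y) y) = Perm b y := by
  have hsub (w : W P) (y : Y) : Perm b y ⊆ Perm b ((w : Y ≃ₗ[ℤ] Y) y) := by
    rintro g ⟨⟨y₁, y₂, ω, hω, h₁, h₂⟩, hg⟩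
    refine ⟨⟨y₁, ⟨t P ((w : Y ≃ₗ[ℤ] Y) y) * (t P y)⁻¹,
      mul_inv_mem_affineWeyl (smul_sub_mem_corootLattice w y)⟩ * y₂, ω, hω, h₁, ?_⟩, ?_⟩
    · rw [Subgroup.coe_mul, mul_assoc, ← h₂, inv_mul_cancel_right]
    · rwa [hull_smul]
  refine (hsub w y).antisymm' ?_
  have h := hsub w⁻¹ ((w : Y ≃ₗ[ℤ] Y) y)
  have hinv : ((w⁻¹ : W P) : Y ≃ₗ[ℤ] Y) ((w : Y ≃ₗ[ℤ] Y) y) = y :=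
    (w : Y ≃ₗ[ℤ] Y).symm_apply_apply y
  rwa [hinv] at h

theorem convex_displacement_preimage (g : ExtAffineWeyl P) {K : Set (V Y)} (hK : Convex ℝ K) :
    Convex ℝ {v | act P g v - v ∈ K} := by
  let f : V Y →ᵃ[ℝ] V Y :=
    ((g.right : Y ≃ₗ[ℤ] Y).toLinearMap.baseChange ℝ - LinearMap.id).toAffineMap +
      AffineMap.const ℝ (V Y) ((1 : ℝ) ⊗ₜ[ℤ] (g.left.toAdd : Y))
  have hf (v : V Y) : act P g v - v = f v := add_sub_right_comm _ _ _
  simp only [hf]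
  exact hK.affine_preimage f

theorem mem_Perm {y : Y} {g ω : ExtAffineWeyl P} (hω : ω ∈ stab b)
    (hωy : (ω.left.toAdd : Y) = y) {w : W P} (hg : (g.left.toAdd : Y) = (w : Y ≃ₗ[ℤ] Y) y)
    (hhull : ∀ v ∈ closedAlcove b, act P g v - v ∈ hull P y) : g ∈ Perm b y := by
  refine ⟨⟨⟨g * ω⁻¹, mul_inv_mem_affineWeyl ?_⟩, ⟨t P y * ω⁻¹, mul_inv_mem_affineWeyl ?_⟩, ω, hω,
    (inv_mul_cancel_right _ _).symm, (inv_mul_cancel_right _ _).symm⟩, hhull⟩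
  · rw [hg, hωy]
    exact smul_sub_mem_corootLattice w y
  · rw [hωy]
    exact (sub_self y).symm ▸ zero_mem _

theorem sum_isPos_root'_refl [Fintype ι] [P.IsReduced] [DecidablePred b.IsPos] {j : ι}
    (hj : j ∈ b.support) (y : Y) :
    ∑ i with b.IsPos i, P.root' i ((refl P j : Y ≃ₗ[ℤ] Y) y) =
      ∑ i with b.IsPos i, P.root' i y - 2 * P.root' j y := by
  classical
  have hjpos : j ∈ ({i | b.IsPos i} : Finset ι) := by
    simpa using RootPairing.Base.isPos_of_mem_support hj
  have hself : P.root' j ((refl P j : Y ≃ₗ[ℤ] Y) y) = -P.root' j y := by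
    rw [coe_refl_apply, map_sub, map_smul, P.root'_coroot_eq_pairing, P.pairing_same, smul_eq_mul]
    ring
  have hmem (i : ι) (hi : i ∈ ({i | b.IsPos i} : Finset ι).erase j) :
      P.reflectionPerm j i ∈ ({i | b.IsPos i} : Finset ι).erase j := by
    rw [Finset.mem_erase, Finset.mem_filter_univ] at hi ⊢
    refine ⟨fun hij => ?_, hi.2.reflectionPerm hj hi.1⟩
    have hi_eq := P.reflectionPerm_self j i
    rw [hij] at hi_eq
    subst hi_eq
    have hpos := RootPairing.Base.isPos_of_mem_support hj
    have hneg := hi.2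
    rw [b.isPos_iff] at hpos hneg
    rw [height_neg] at hneg
    lia
  have hrest : ∑ i ∈ ({i | b.IsPos i} : Finset ι).erase j, P.root' i ((refl P j : Y ≃ₗ[ℤ] Y) y) =
      ∑ i ∈ ({i | b.IsPos i} : Finset ι).erase j, P.root' i y := by
    refine Finset.sum_equiv (P.reflectionPerm j) (fun i => ⟨hmem i, fun hi => ?_⟩)
      fun i _ => root'_refl_apply j i y
    exact P.reflectionPerm_self j i ▸ hmem _ hi
  rw [← Finset.add_sum_erase _ _ hjpos, ← Finset.add_sum_erase _ _ hjpos, hself, hrest]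
  ring

theorem exists_isDominant_smul [Finite ι] [P.IsReduced] (b : P.Base) (y : Y) :
    ∃ w : W P, IsDominant b ((w : Y ≃ₗ[ℤ] Y) y) := by
  classical
  have : Fintype ι := Fintype.ofFinite ι
  let f (w : W P) : ℤ := ∑ i with b.IsPos i, P.root' i ((w : Y ≃ₗ[ℤ] Y) y)
  have hfinite : (Set.range f).Finite := by
    refine (Set.finite_range fun σ : ι → ι => ∑ i with b.IsPos i, P.root' (σ i) y).subset ?_
    rintro _ ⟨w, rfl⟩
    exact ⟨rootIndex w⁻¹, Finset.sum_congr rfl fun i _ => (root'_apply_eq_rootIndex_inv w i y).symm⟩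
  obtain ⟨_, ⟨w, rfl⟩, hmax⟩ := hfinite.exists_maximal (Set.range_nonempty f)
  refine ⟨w, fun j hj => ?_⟩
  have hrefl : f (refl P j * w) = f w - 2 * P.root' j ((w : Y ≃ₗ[ℤ] Y) y) :=
    sum_isPos_root'_refl hj _
  by_contra! hneg
  have := hmax (Set.mem_range_self (refl P j * w)) (by rw [hrefl]; linarith)
  linarith

end AffineWeyl

/-! ### The roots of `E₆` -/

namespace E6

open Matrix RootDatum AffineWeyl

/-- The list of the positive roots. -/
def posRoots : List L := [
  ![0, 0, 0, 0, 0, 1], ![0, 0, 0, 0, 1, 0], ![0, 0, 0, 1, 0, 0], ![0, 0, 1, 0, 0, 0],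
  ![0, 1, 0, 0, 0, 0], ![1, 0, 0, 0, 0, 0], ![0, 0, 0, 0, 1, 1], ![0, 0, 0, 1, 1, 0],
  ![0, 0, 1, 1, 0, 0], ![0, 1, 0, 1, 0, 0], ![1, 0, 1, 0, 0, 0], ![0, 0, 0, 1, 1, 1],
  ![0, 0, 1, 1, 1, 0], ![0, 1, 0, 1, 1, 0], ![0, 1, 1, 1, 0, 0], ![1, 0, 1, 1, 0, 0],
  ![0, 0, 1, 1, 1, 1], ![0, 1, 0, 1, 1, 1], ![0, 1, 1, 1, 1, 0], ![1, 0, 1, 1, 1, 0],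
  ![1, 1, 1, 1, 0, 0], ![0, 1, 1, 1, 1, 1], ![0, 1, 1, 2, 1, 0], ![1, 0, 1, 1, 1, 1],
  ![1, 1, 1, 1, 1, 0], ![0, 1, 1, 2, 1, 1], ![1, 1, 1, 1, 1, 1], ![1, 1, 1, 2, 1, 0],
  ![0, 1, 1, 2, 2, 1], ![1, 1, 1, 2, 1, 1], ![1, 1, 2, 2, 1, 0], ![1, 1, 1, 2, 2, 1],
  ![1, 1, 2, 2, 1, 1], ![1, 1, 2, 2, 2, 1], ![1, 1, 2, 3, 2, 1], ![1, 2, 2, 3, 2, 1]]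

/-- The list of all roots; with it, statements about all roots can be decided. -/
def roots : List L := posRoots ++ posRoots.map Neg.neg

set_option synthInstance.maxSize 4000 in
theorem mem_posRoots_of_bounded : ∀ a < (3 : ℕ), ∀ b < (3 : ℕ), ∀ c < (4 : ℕ), ∀ d < (4 : ℕ),
    ∀ e < (4 : ℕ), ∀ f < (3 : ℕ),
    (a : ℤ) ^ 2 + b ^ 2 + c ^ 2 + d ^ 2 + e ^ 2 + f ^ 2
      - a * c - b * d - c * d - d * e - e * f = 1 → (![a, b, c, d, e, f] : L) ∈ posRoots := by
  decide +kernel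

theorem mem_posRoots (n : Idx) (h : ∀ i, 0 ≤ n.1 i) : n.1 ∈ posRoots := by
  obtain ⟨n, hn⟩ := n
  lift n to Fin 6 → ℕ using h
  have hcoord : (fun i => (n i : ℤ)) = ![(n 0 : ℤ), n 1, n 2, n 3, n 4, n 5] := by
    ext i
    fin_cases i <;> rfl
  have hsquares : 6 * (2 * n 0 - n 2 : ℤ) ^ 2 + 6 * (2 * n 1 - n 3 : ℤ) ^ 2
      + 2 * (3 * n 2 - 2 * n 3 : ℤ) ^ 2 + 6 * (2 * n 5 - n 4 : ℤ) ^ 2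
      + 2 * (3 * n 4 - 2 * n 3 : ℤ) ^ 2 + 2 * (n 3 : ℤ) ^ 2 = 24 := by
    rw [q_self] at hn
    linarith
  have h3 : n 3 < 4 := by zify; nlinarith
  have h1 : (2 * n 1 - n 3 : ℤ) ≤ 2 := by nlinarith
  have h2 : (3 * n 2 - 2 * n 3 : ℤ) ≤ 3 := by nlinarith
  have h4 : (3 * n 4 - 2 * n 3 : ℤ) ≤ 3 := by nlinarith
  have h0 : (2 * n 0 - n 2 : ℤ) ≤ 2 := by nlinarith
  have h5 : (2 * n 5 - n 4 : ℤ) ≤ 2 := by nlinarith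
  rw [q_self] at hn
  simp only [hcoord]
  exact mem_posRoots_of_bounded _ (by lia) _ (by lia) _ (by lia) _ h3 _ (by lia) _ (by lia)
    (by linarith)

theorem mem_roots (n : Idx) : n.1 ∈ roots := by
  obtain h | h := nonneg_or_nonpos n
  · exact List.mem_append_left _ (mem_posRoots n h)
  · have hn : q (-n.1) (-n.1) = 2 := by
      rw [q, mulVec_neg, neg_dotProduct_neg]
      exact n.2
    exact List.mem_append_right _ (List.mem_map.2 ⟨_, mem_posRoots ⟨-n.1, hn⟩ h, neg_neg _⟩)

theorem q_eq_two_of_mem_roots : ∀ n ∈ roots, q n n = 2 := by decide +kernel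

instance : Finite Idx :=
  ((List.finite_toSet roots).subset fun n hn => mem_roots ⟨n, hn⟩).to_subtype

instance : datum.IsReduced where
  eq_or_eq_neg i j h := by
    rw [LinearIndependent.pair_iff] at h
    push Not at h
    obtain ⟨a, b, hab, hne⟩ := h
    change a • i.1 + b • j.1 = 0 at hab
    have hsq : a ^ 2 = b ^ 2 := by
      have hai : a • i.1 = (-b) • j.1 := by rw [neg_smul]; exact eq_neg_of_add_eq_zero_left hab
      have hq : q (a • i.1) (a • i.1) = q ((-b) • j.1) ((-b) • j.1) := by rw [hai]
      simp only [q_smul, q_comm _ (_ • _), i.2, j.2] at hq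
      linarith
    have ha : a ≠ 0 := by
      rintro rfl
      exact hne rfl (by simpa using hsq.symm)
    obtain rfl | rfl := sq_eq_sq_iff_eq_or_eq_neg.1 hsq
    · exact .inr (eq_neg_of_add_eq_zero_left ((smul_eq_zero_iff_right ha).1 (by rwa [smul_add])))
    · refine .inl (sub_eq_zero.1 ((smul_eq_zero_iff_right (neg_ne_zero.1 ha)).1 ?_))
      change b • (i.1 - j.1) = 0
      rw [smul_sub, ← neg_eq_zero, neg_sub, sub_eq_neg_add, ← neg_smul, hab]

theorem root'_apply (n : Idx) (z : L) : datum.root' n z = n.1 ⬝ᵥ z := rfl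

theorem root'_simple (i : Fin 6) (z : L) : datum.root' (simple i) z = z i := by
  rw [root'_apply, simple, single_one_dotProduct]

theorem mem_support_base {n : Idx} : n ∈ base.support ↔ ∃ i, simple i = n := by simp [base]

/-- The highest root. -/
def theta : Idx := ⟨![1, 2, 2, 3, 2, 1], by decide⟩

theorem isHighest_theta : IsHighest base theta := fun n => by
  have hle : ∀ n ∈ roots, ∀ i, n i ≤ theta.1 i := by decide +kernel
  exact mem_closure_simple fun i => sub_nonneg.2 (hle n.1 (mem_roots n) i)

theorem eq_theta_of_isHighest {n : Idx} (hn : IsHighest base n) : n = theta :=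
  eq_of_height_le isHighest_theta (height_le hn theta)

/-- The point `ρ^∨ / h` of the base alcove, where `ρ^∨` is the sum of the fundamental coweights and
`h = 12` is the Coxeter number. -/
def center : V L := (12 : ℝ)⁻¹ ⊗ₜ[ℤ] (1 : L)

theorem center_mem_alcove : center ∈ alcove base := by
  refine ⟨fun n hn => ?_, fun n hn => ?_⟩
  · obtain ⟨i, rfl⟩ := mem_support_base.1 hn
    rw [center, pair_tmul, root'_simple]
    norm_num
  · have hheight : theta.1 ⬝ᵥ 1 = 11 := by decide
    rw [eq_theta_of_isHighest hn, center, pair_tmul, root'_apply, hheight]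
    norm_num

theorem mem_stab_of_smul_add {ω : ExtAffineWeyl datum}
    (hω : (ω.right : L ≃ₗ[ℤ] L) 1 + (12 : ℤ) • (ω.left.toAdd : L) = 1) : ω ∈ stab base := by
  refine AffineRoot.mem_stab_of_mem_alcove isHighest_theta center_mem_alcove ?_
  have hfix : act datum ω center = center := by
    conv_rhs => rw [center, ← hω, TensorProduct.tmul_add, TensorProduct.tmul_smul]
    rw [act, TensorProduct.smul_tmul']
    norm_num [center]
  rw [hfix]
  exact center_mem_alcove

/-! ### An obstruction to admissibility -/

/-- The point `z / 3` of `V`, for `z` in the coweight lattice. The base alcove has the vertex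
`third (rho 3)`, which belongs to the branch node of the Dynkin diagram. -/
def third (z : L) : V L := (3 : ℝ)⁻¹ ⊗ₜ[ℤ] z

theorem pair_third (n : Idx) (z : L) : pair datum n (third z) = (3 : ℝ)⁻¹ * (n.1 ⬝ᵥ z : ℤ) :=
  pair_tmul ..

theorem eval_third (a : AffineRoot datum) (z : L) :
    a.eval (third z) = (3 : ℝ)⁻¹ * (a.root.1 ⬝ᵥ z + 3 * a.const : ℤ) := by
  rw [AffineRoot.eval, pair_third]
  push_cast
  ring

/-- The reflection in the hyperplane of the affine root `n + k`, in the coordinates of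
`third`. -/
def reflectThird (n : L) (k : ℤ) (z : L) : L := z - (n ⬝ᵥ z + 3 * k) • (CartanMatrix.E₆ *ᵥ n)

theorem act_reflection_third (a : AffineRoot datum) (z : L) :
    act datum a.reflection (third z) = third (reflectThird a.root.1 a.const z) := by
  rw [AffineRoot.act_reflection, eval_third, mul_comm, mul_smul, TensorProduct.smul_tmul',
    Int.cast_smul_eq_zsmul, smul_eq_mul, mul_one, third, third, reflectThird,
    TensorProduct.tmul_sub, TensorProduct.tmul_smul]
  rfl

theorem dotProduct_reflectThird (n : Idx) (k : ℤ) (z : L) :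
    n.1 ⬝ᵥ reflectThird n.1 k z = -(n.1 ⬝ᵥ z + 6 * k) := by
  have hq : n.1 ⬝ᵥ (CartanMatrix.E₆ *ᵥ n.1) = 2 := n.2
  rw [reflectThird, dotProduct_sub, dotProduct_smul, hq, smul_eq_mul]
  ring

theorem isPositive_iff (a : AffineRoot datum) :
    AffineRoot.IsPositive base a ↔ 0 < a.root.1 ⬝ᵥ 1 + 12 * a.const := by
  have heval : a.eval center = (12 : ℝ)⁻¹ * (a.root.1 ⬝ᵥ 1 + 12 * a.const : ℤ) := by
    rw [AffineRoot.eval, center, pair_tmul, root'_apply]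
    push_cast
    ring
  rw [AffineRoot.isPositive_iff_eval_pos isHighest_theta center_mem_alcove, heval,
    mul_pos_iff_of_pos_left (by norm_num), Int.cast_pos]

theorem pair_simple_third_rho_nonneg {n : Idx} (hn : n ∈ base.support) :
    0 ≤ pair datum n (third (rho 3)) := by
  obtain ⟨i, rfl⟩ := mem_support_base.1 hn
  rw [third, pair_tmul, root_rho]
  split <;> norm_num

theorem pair_theta_third_rho : pair datum theta (third (rho 3)) = 1 := by
  have hdot : theta.1 ⬝ᵥ rho 3 = 3 := by decide
  rw [pair_third, hdot]
  norm_num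

/-- The points `z / 3` with `z ∈ U` form, together with all points whose difference to `ρ₄ / 3`
pairs with some root to more than `1`, an upward closed set that contains no translate of `ρ₄ / 3`
by a minuscule coweight. The condition `far` is responsible for the affine roots `n + k` with
`k ≥ 3`, so that `step` has to be checked for finitely many affine roots only. -/
structure IsObstruction (U : List L) : Prop where
  not_dvd : ∀ z ∈ U, ¬ 3 ∣ z 3 - 1
  far : ∀ z ∈ U, ∀ n ∈ roots, -15 < n ⬝ᵥ z + n 3
  step : ∀ z ∈ U, ∀ n ∈ roots, ∀ k ∈ [(0 : ℤ), 1, 2], 0 < n ⬝ᵥ 1 + 12 * k →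
    0 < n ⬝ᵥ z + 3 * k → reflectThird n k z ∈ U ∨
      ∃ m ∈ roots, 3 < m ⬝ᵥ (reflectThird n k z - rho 3)

variable {U : List L}

theorem third_mem_farPoints {z : L} (n : Idx) (h : 3 < n.1 ⬝ᵥ (z - rho 3)) :
    third z ∈ farPoints datum (third (rho 3)) 1 := by
  refine ⟨n, ?_⟩
  rw [third, third, ← TensorProduct.tmul_sub, ← third, pair_third, lt_inv_mul_iff₀ three_pos]
  exact_mod_cast h

theorem IsObstruction.isUpwardClosed (hU : IsObstruction U) : IsUpwardClosed base
    (third '' {z | z ∈ U} ∪ farPoints datum (third (rho 3)) 1) := by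
  rintro _ (⟨z, hz, rfl⟩ | hp) a ha hpos
  · rw [isPositive_iff] at ha
    rw [eval_third, mul_pos_iff_of_pos_left (by norm_num), Int.cast_pos] at hpos
    rw [act_reflection_third]
    have hroot := mem_roots a.root
    have hheight : ∀ n ∈ roots, n ⬝ᵥ 1 < 12 := by decide +kernel
    have hconst : 0 ≤ a.const := by linarith [hheight _ hroot]
    obtain hlt | hle := lt_or_ge a.const 3
    · have hmem : a.const ∈ [(0 : ℤ), 1, 2] := by simp only [List.mem_cons]; lia
      obtain h | ⟨m, hm, hfar⟩ := hU.step z hz _ hroot _ hmem ha hpos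
      · exact .inl ⟨_, h, rfl⟩
      · exact .inr (third_mem_farPoints ⟨m, q_eq_two_of_mem_roots m hm⟩ hfar)
    · let n' : Idx := datum.reflectionPerm a.root a.root
      have hn' : n'.1 = -a.root.1 :=
        (datum.root_reflectionPerm _ _).trans (datum.reflection_apply_self _)
      refine .inr (third_mem_farPoints n' ?_)
      rw [hn', neg_dotProduct, dotProduct_sub, dotProduct_reflectThird, rho, dotProduct_single_one]
      linarith [hU.far z hz _ hroot]
  · exact .inr (isUpwardClosed_farPoints isHighest_theta (fun _ => pair_simple_third_rho_nonneg)
      pair_theta_third_rho.le 1 _ hp a ha hpos)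

theorem IsObstruction.not_mem_Adm (hU : IsObstruction U) {μ : L} (hμ : IsMinuscule datum μ)
    {g : ExtAffineWeyl datum} {z : L} (hz : z ∈ U) (hg : act datum g (third (rho 3)) = third z) :
    g ∉ Adm base μ := by
  rintro ⟨w, hle⟩
  let ν := (w : L ≃ₗ[ℤ] L) μ
  have hν : IsMinuscule datum ν := isMinuscule_smul hμ w
  have hmem := hU.isUpwardClosed.act_mem_of_bruhatLE isHighest_theta ⟨center, center_mem_alcove⟩
    (fun _ => pair_simple_third_rho_nonneg) pair_theta_third_rho.le hle (.inl ⟨z, hz, hg.symm⟩)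
  rw [act_t] at hmem
  obtain ⟨z', hz', heq⟩ | ⟨n, hn⟩ := hmem
  · refine hU.not_dvd z' hz' ⟨ν 3, ?_⟩
    have hcoord := congrArg (pair datum (simple 3)) heq
    rw [map_add, third, third, pair_tmul, pair_tmul, pair_tmul, root'_simple, root'_simple,
      root'_simple, rho, Pi.single_eq_same, Int.cast_one] at hcoord
    have : (z' 3 : ℝ) - 1 = 3 * ν 3 := by linarith
    exact_mod_cast this
  · rw [add_sub_cancel_left, pair_tmul, one_mul, ← Int.cast_one, Int.cast_lt] at hn
    have := hν n
    lia

/-! ### Permissibility -/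

/-- The product of a word in the simple reflections. -/
def word (l : List (Fin 6)) : W datum := (l.map s).prod

/-- The action of a word in the simple reflections on the coweight lattice, in a form in which it
can be evaluated. -/
def wordAct (l : List (Fin 6)) (z : L) : L :=
  l.foldr (fun i z => z - z i • (CartanMatrix.E₆ *ᵥ Pi.single i 1)) z

theorem s_apply (i : Fin 6) (z : L) :
    (s i : L ≃ₗ[ℤ] L) z = z - z i • (CartanMatrix.E₆ *ᵥ Pi.single i 1) := by
  rw [s, coe_refl_apply, root'_simple]
  rfl

theorem word_apply (l : List (Fin 6)) (z : L) : (word l : L ≃ₗ[ℤ] L) z = wordAct l z := by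
  induction l with
  | nil => rfl
  | cons i l ih =>
    change (s i : L ≃ₗ[ℤ] L) ((word l : L ≃ₗ[ℤ] L) z) = _
    rw [ih, s_apply]
    rfl

theorem word_append (l l' : List (Fin 6)) : word (l ++ l') = word l * word l' := by
  rw [word, List.map_append, List.prod_append, ← word, ← word]

theorem word_inv (l : List (Fin 6)) : (word l)⁻¹ = word l.reverse := by
  rw [word, word, List.prod_inv_reverse, List.map_map, ← List.map_reverse]
  exact congrArg List.prod (List.map_congr_left fun i _ => refl_inv (simple i))

/-- The element `w t_μ w'⁻¹`, where `w` and `w'` are the products of the words `u` and `v`. -/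
def elt (u v : List (Fin 6)) (μ : L) : ExtAffineWeyl datum :=
  fin datum (word u) * t datum μ * (fin datum (word v))⁻¹

theorem elt_eq_t_mul_fin (u v : List (Fin 6)) (μ : L) :
    elt u v μ = t datum (wordAct u μ) * fin datum (word (u ++ v.reverse)) := by
  rw [elt, fin_mul_t, mul_assoc, ← map_inv, ← map_mul, word_inv, ← word_append, word_apply]

theorem act_elt_tmul (u v : List (Fin 6)) (μ : L) (r : ℝ) (z : L) :
    act datum (elt u v μ) (r ⊗ₜ z) = r ⊗ₜ wordAct (u ++ v.reverse) z + 1 ⊗ₜ wordAct u μ := by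
  rw [← word_apply, elt_eq_t_mul_fin, act_mul, act_t, act]
  congr 1
  exact (congrArg _ (TensorProduct.tmul_zero ..)).trans (add_zero _)

theorem act_elt_third (u v : List (Fin 6)) (μ z : L) :
    act datum (elt u v μ) (third z) =
      third (wordAct (u ++ v.reverse) z + (3 : ℤ) • wordAct u μ) := by
  rw [third, act_elt_tmul, third, TensorProduct.tmul_add, TensorProduct.tmul_smul,
    TensorProduct.smul_tmul']
  norm_num

theorem eq_sum_rho (v : V L) : v = ∑ i, pair datum (simple i) v • (1 : ℝ) ⊗ₜ[ℤ] rho i := by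
  induction v using TensorProduct.induction_on with
  | zero => simp
  | tmul r z =>
    have hz : z = ∑ i, z i • rho i := pi_eq_sum_univ' z
    conv_lhs => rw [hz, TensorProduct.tmul_sum]
    refine Finset.sum_congr rfl fun i _ => ?_
    rw [pair_tmul, root'_simple, TensorProduct.tmul_smul, mul_comm, mul_smul,
      TensorProduct.smul_tmul' r, smul_eq_mul, mul_one, Int.cast_smul_eq_zsmul]
  | add v w hv hw =>
    simp only [map_add, add_smul, Finset.sum_add_distrib]
    rw [← hv, ← hw]

/-- The vertices of the base alcove: the origin, and the points `ρ_i / n_i` with `n_i` the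
coefficient of `α_i` in the highest root. -/
def vertex : Option (Fin 6) → V L
  | none => 0
  | some i => (theta.1 i : ℝ)⁻¹ ⊗ₜ rho i

theorem theta_pos : ∀ i, 0 < theta.1 i := by decide

theorem pair_theta_eq_sum (v : V L) :
    pair datum theta v = ∑ i, theta.1 i * pair datum (simple i) v := by
  conv_lhs => rw [eq_sum_rho v, map_sum]
  refine Finset.sum_congr rfl fun i _ => ?_
  rw [map_smul, pair_tmul, root'_apply, rho, dotProduct_single_one, one_mul, smul_eq_mul, mul_comm]

theorem closedAlcove_subset_convexHull : closedAlcove base ⊆ convexHull ℝ (Set.range vertex) := by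
  intro v hv
  obtain ⟨hsimple, htheta⟩ := nonneg_of_mem_closedAlcove isHighest_theta hv
  let weight : Option (Fin 6) → ℝ
    | none => 1 - pair datum theta v
    | some i => theta.1 i * pair datum (simple i) v
  have hcomb : v = ∑ o, weight o • vertex o := by
    rw [Fintype.sum_option, vertex, smul_zero, zero_add]
    conv_lhs => rw [eq_sum_rho v]
    refine Finset.sum_congr rfl fun i _ => ?_
    have hne : (theta.1 i : ℝ) ≠ 0 := by exact_mod_cast (theta_pos i).ne'
    have hweight : weight (some i) * (theta.1 i : ℝ)⁻¹ = pair datum (simple i) v :=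
      by
      rw [mul_comm, inv_mul_cancel_left₀ hne]
    rw [vertex, TensorProduct.smul_tmul', TensorProduct.smul_tmul', smul_eq_mul, smul_eq_mul,
      mul_one, hweight]
  rw [hcomb]
  refine (convex_convexHull ℝ _).sum_mem (fun o _ => ?_) ?_ fun o _ =>
    subset_convexHull ℝ _ ⟨o, rfl⟩
  · obtain _ | i := o
    · exact sub_nonneg.2 htheta
    · exact mul_nonneg (by exact_mod_cast (theta_pos i).le)
        (hsimple _ (mem_support_base.2 ⟨i, rfl⟩))
  · rw [Fintype.sum_option, ← pair_theta_eq_sum, sub_add_cancel]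

theorem inv_length_smul_sum_mem {𝕜 E : Type*} [Field 𝕜] [LinearOrder 𝕜] [IsStrictOrderedRing 𝕜]
    [AddCommGroup E] [Module 𝕜 E] {K : Set E} (hK : Convex 𝕜 K) {l : List E} (hne : l ≠ [])
    (hl : ∀ z ∈ l, z ∈ K) : (l.length : 𝕜)⁻¹ • l.sum ∈ K := by
  have hlength : (l.length : 𝕜) ≠ 0 := by exact_mod_cast mt List.length_eq_zero_iff.1 hne
  rw [← Fin.sum_univ_getElem l, Finset.smul_sum]
  exact hK.sum_mem (fun _ _ => by positivity) (by simp [hlength]) fun i _ => hl _ (by simp)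

theorem tmul_wordAct_mem_hull (l : List (Fin 6)) (μ : L) : 1 ⊗ₜ wordAct l μ ∈ hull datum μ :=
  subset_convexHull ℝ _ ⟨word l, by rw [word_apply]⟩

theorem inv_length_tmul_sum_mem_hull {c : List (List (Fin 6))} (hne : c ≠ []) (μ : L) :
    (c.length : ℝ)⁻¹ ⊗ₜ (c.map fun l => wordAct l μ).sum ∈ hull datum μ := by
  have hmap : (c.map fun l => (1 : ℝ) ⊗ₜ[ℤ] wordAct l μ).sum =
      1 ⊗ₜ (c.map fun l => wordAct l μ).sum := by
    rw [← TensorProduct.mk_apply, map_list_sum, List.map_map]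
    rfl
  have h := inv_length_smul_sum_mem (convex_convexHull ℝ _)
    (l := c.map fun l => (1 : ℝ) ⊗ₜ wordAct l μ) (by simpa using hne)
    (List.forall_mem_map.2 fun l _ => tmul_wordAct_mem_hull l μ)
  rwa [List.length_map, hmap, TensorProduct.smul_tmul', smul_eq_mul, mul_one] at h

theorem act_elt_vertex_sub_mem_hull (u v : List (Fin 6)) {μ : L} (c : Fin 6 → List (List (Fin 6)))
    (hlength : ∀ i, ((c i).length : ℤ) = theta.1 i)
    (hsum : ∀ i, ((c i).map fun l => wordAct l μ).sum =
      wordAct (u ++ v.reverse) (rho i) - rho i + theta.1 i • wordAct u μ) :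
    ∀ o, act datum (elt u v μ) (vertex o) - vertex o ∈ hull datum μ
  | none => by
    have hzero : act datum (elt u v μ) 0 = 1 ⊗ₜ wordAct u μ := by
      simpa using act_elt_tmul u v μ 0 0
    rw [vertex, sub_zero, hzero]
    exact tmul_wordAct_mem_hull u μ
  | some i => by
    have hn : ((c i).length : ℝ) = theta.1 i := by exact_mod_cast hlength i
    have hn₀ : (theta.1 i : ℝ) ≠ 0 := by exact_mod_cast (theta_pos i).ne'
    have hne : c i ≠ [] := fun h => hn₀ (by rw [← hn, h, List.length_nil, Nat.cast_zero])
    have hdisp : act datum (elt u v μ) (vertex (some i)) - vertex (some i) =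
        ((c i).length : ℝ)⁻¹ ⊗ₜ ((c i).map fun l => wordAct l μ).sum := by
      rw [vertex, act_elt_tmul, hsum, hn, TensorProduct.tmul_add, TensorProduct.tmul_sub,
        TensorProduct.tmul_smul, TensorProduct.smul_tmul', ← Int.cast_smul_eq_zsmul ℝ,
        smul_eq_mul, mul_inv_cancel₀ hn₀]
      abel
    rw [hdisp]
    exact inv_length_tmul_sum_mem_hull hne μ

/-- The word `r` exhibits an element `t_μ w` of `Ω`, and the words `c i` exhibit the displacement of
the vertex `ρ_i / n_i` as the average of `n_i` points of the orbit of `μ`. -/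
theorem elt_mem_Perm (u v r : List (Fin 6)) {μ : L} (c : Fin 6 → List (List (Fin 6)))
    (hr : wordAct r 1 + (12 : ℤ) • μ = 1) (hlength : ∀ i, ((c i).length : ℤ) = theta.1 i)
    (hsum : ∀ i, ((c i).map fun l => wordAct l μ).sum =
      wordAct (u ++ v.reverse) (rho i) - rho i + theta.1 i • wordAct u μ) :
    elt u v μ ∈ Perm base μ := by
  have hω : (⟨.ofAdd μ, word r⟩ : ExtAffineWeyl datum) ∈ stab base :=
    mem_stab_of_smul_add (by rwa [word_apply])
  have hleft : ((elt u v μ).left.toAdd : L) = (word u : L ≃ₗ[ℤ] L) μ := by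
    rw [elt_eq_t_mul_fin, word_apply]
    exact add_zero _
  exact mem_Perm hω rfl hleft (closedAlcove_subset_convexHull.trans <|
    convexHull_min (Set.range_subset_iff.2 (act_elt_vertex_sub_mem_hull u v c hlength hsum))
      (convex_displacement_preimage _ (convex_convexHull ℝ _)))

theorem x_eq_elt : x = elt [3, 4, 5, 1, 3, 4] [1, 3, 4, 5, 2, 3, 4, 1, 3, 2, 0] (rho 0) := by
  simp only [x, w₁, w₂, elt, word, List.map_cons, List.map_nil, List.prod_cons, List.prod_nil,
    mul_one, mul_assoc]

theorem x_mem_Perm : x ∈ Perm base (rho 0) := by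
  rw [x_eq_elt]
  refine elt_mem_Perm _ _ [0, 2, 3, 1, 4, 3, 2, 0, 5, 4, 3, 1, 2, 3, 4, 5]
    ![[[0]],
      [[1, 3, 4, 5, 0, 2, 3, 4, 1, 3, 2, 0], []],
      [[0], [3, 4, 5, 2, 3, 4, 1, 3, 2, 0]],
      [[3, 4, 1, 3, 2, 0], [5, 3, 4, 1, 3, 2, 0], [4, 5, 3, 4, 1, 3, 2, 0]],
      [[3, 4, 1, 3, 2, 0], [4, 5, 3, 4, 1, 3, 2, 0]],
      [[5, 3, 4, 1, 3, 2, 0]]] ?_ ?_ ?_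
  all_goals decide +kernel

/-- The image of `x` under the automorphism of the Dynkin diagram. -/
def x' : ExtAffineWeyl datum :=
  elt [3, 2, 0, 1, 3, 2] [1, 3, 2, 0, 4, 3, 2, 1, 3, 4, 5] (rho 5)

theorem x'_mem_Perm : x' ∈ Perm base (rho 5) := by
  refine elt_mem_Perm _ _ [5, 4, 3, 1, 2, 3, 4, 5, 0, 2, 3, 1, 4, 3, 2, 0]
    ![[[0, 3, 2, 1, 3, 4, 5]],
      [[1, 3, 2, 0, 5, 4, 3, 2, 1, 3, 4, 5], []],
      [[3, 2, 1, 3, 4, 5], [2, 0, 3, 2, 1, 3, 4, 5]],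
      [[3, 2, 1, 3, 4, 5], [0, 3, 2, 1, 3, 4, 5], [2, 0, 3, 2, 1, 3, 4, 5]],
      [[5], [3, 2, 0, 4, 3, 2, 1, 3, 4, 5]],
      [[5]]] ?_ ?_ ?_
  all_goals decide +kernel

theorem isMinuscule_rho_zero : IsMinuscule datum (rho 0) := fun n => by
  have h : ∀ n ∈ roots, n ⬝ᵥ rho 0 = -1 ∨ n ⬝ᵥ rho 0 = 0 ∨ n ⬝ᵥ rho 0 = 1 := by decide +kernel
  exact h _ (mem_roots n)

theorem isMinuscule_rho_five : IsMinuscule datum (rho 5) := fun n => by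
  have h : ∀ n ∈ roots, n ⬝ᵥ rho 5 = -1 ∨ n ⬝ᵥ rho 5 = 0 ∨ n ⬝ᵥ rho 5 = 1 := by decide +kernel
  exact h _ (mem_roots n)

theorem isObstruction_zero :
    IsObstruction [![3, 0, -3, 2, 0, 0], ![-3, 0, 0, 2, 0, 0], ![0, 0, 3, -1, 0, 0]] where
  not_dvd := by decide +kernel
  far := by decide +kernel
  step := by decide +kernel

theorem isObstruction_five :
    IsObstruction [![0, 0, 0, 2, -3, 3], ![0, 0, 0, 2, 0, -3], ![0, 0, 0, -1, 3, 0]] where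
  not_dvd := by decide +kernel
  far := by decide +kernel
  step := by decide +kernel

theorem x_not_mem_Adm : x ∉ Adm base (rho 0) := by
  rw [x_eq_elt]
  exact isObstruction_zero.not_mem_Adm isMinuscule_rho_zero (by decide +kernel)
    (act_elt_third _ _ _ _)

theorem x'_not_mem_Adm : x' ∉ Adm base (rho 5) :=
  isObstruction_five.not_mem_Adm isMinuscule_rho_five (by decide +kernel) (act_elt_third _ _ _ _)

theorem Adm_ne_Perm_rho_zero : Adm base (rho 0) ≠ Perm base (rho 0) := fun h =>
  x_not_mem_Adm (h ▸ x_mem_Perm)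

theorem Adm_ne_Perm_rho_five : Adm base (rho 5) ≠ Perm base (rho 5) := fun h =>
  x'_not_mem_Adm (h ▸ x'_mem_Perm)

theorem isDominant_iff {μ : L} : IsDominant base μ ↔ ∀ i, 0 ≤ μ i := by
  simp only [IsDominant, mem_support_base, forall_exists_index, forall_apply_eq_imp_iff,
    root'_simple]

theorem root'_theta (μ : L) :
    datum.root' theta μ = μ 0 + 2 * μ 1 + 2 * μ 2 + 3 * μ 3 + 2 * μ 4 + μ 5 := by
  simp only [root'_apply, theta, dotProduct, Fin.sum_univ_six]
  exact congrArg₂ _ (by simp) (one_mul _)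

theorem eq_rho_of_isMinuscule_of_isDominant {μ : L} (hm : IsMinuscule datum μ)
    (hd : IsDominant base μ) (hne : μ ≠ 0) : μ = rho 0 ∨ μ = rho 5 := by
  have hnonneg := isDominant_iff.1 hd
  have htheta : datum.root' theta μ ≤ 1 := by
    have := hm theta
    lia
  rw [root'_theta] at htheta
  have := hnonneg 0; have := hnonneg 1; have := hnonneg 2
  have := hnonneg 3; have := hnonneg 4; have := hnonneg 5
  have hsupport : μ = ![μ 0, 0, 0, 0, 0, μ 5] := by
    ext i
    fin_cases i
    exacts [rfl, show μ 1 = 0 by lia, show μ 2 = 0 by lia, show μ 3 = 0 by lia,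
      show μ 4 = 0 by lia, rfl]
  have hends : μ 0 = 0 ∧ μ 5 = 0 ∨ μ 0 = 1 ∧ μ 5 = 0 ∨ μ 0 = 0 ∧ μ 5 = 1 := by lia
  obtain ⟨h₀, h₅⟩ | ⟨h₀, h₅⟩ | ⟨h₀, h₅⟩ := hends <;> rw [h₀, h₅] at hsupport
  · exact absurd (hsupport.trans (by decide)) hne
  · exact .inl (hsupport.trans (by decide))
  · exact .inr (hsupport.trans (by decide))

theorem minuscule_dominant_iff (μ : L) :
    (IsMinuscule datum μ ∧ IsDominant base μ ∧ μ ≠ 0) ↔ (μ = rho 0 ∨ μ = rho 5) := by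
  refine ⟨fun ⟨hm, hd, hne⟩ => eq_rho_of_isMinuscule_of_isDominant hm hd hne, ?_⟩
  rintro (rfl | rfl)
  · exact ⟨isMinuscule_rho_zero, isDominant_iff.2 (by decide), by decide⟩
  · exact ⟨isMinuscule_rho_five, isDominant_iff.2 (by decide), by decide⟩

theorem Adm_ne_Perm {μ : L} (hm : IsMinuscule datum μ) (hne : μ ≠ 0) :
    Adm base μ ≠ Perm base μ := by
  obtain ⟨w, hd⟩ := exists_isDominant_smul base μ
  rw [← Adm_smul base w, ← Perm_smul base w]
  obtain h | h := eq_rho_of_isMinuscule_of_isDominant (isMinuscule_smul hm w) hd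
    ((map_ne_zero_iff _ (w : L ≃ₗ[ℤ] L).injective).2 hne)
  · exact h ▸ Adm_ne_Perm_rho_zero
  · exact h ▸ Adm_ne_Perm_rho_five

end E6

theorem mainTheorem1 :
    (E6.x ∈ RootDatum.Perm E6.base (E6.rho 0) ∧ E6.x ∉ RootDatum.Adm E6.base (E6.rho 0)) ∧
    RootDatum.Adm E6.base (E6.rho 0) ≠ RootDatum.Perm E6.base (E6.rho 0) ∧
    RootDatum.Adm E6.base (E6.rho 5) ≠ RootDatum.Perm E6.base (E6.rho 5) ∧
    (∀ μ : E6.L, (RootDatum.IsMinuscule E6.datum μ ∧ RootDatum.IsDominant E6.base μ ∧ μ ≠ 0) ↔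
      (μ = E6.rho 0 ∨ μ = E6.rho 5)) ∧
    (∀ μ : E6.L, RootDatum.IsMinuscule E6.datum μ → μ ≠ 0 →
      RootDatum.Adm E6.base μ ≠ RootDatum.Perm E6.base μ) :=
  ⟨⟨E6.x_mem_Perm, E6.x_not_mem_Adm⟩, E6.Adm_ne_Perm_rho_zero, E6.Adm_ne_Perm_rho_five,
    E6.minuscule_dominant_iff, fun _ hμ hne => E6.Adm_ne_Perm hμ hne⟩
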